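/- Let $F_0\subseteq F_1\subseteq F_2$ be algebraic function fields over a finite field $\mathbb F_q$, with $\mathbb F_q$ the full constant field of each, such that $F_1/F_0$ and $F_2/F_1$ are finite and separable. An AG-code over a function field $F/\mathbb F_q$ is presented by two disjoint divisors $D=P_1+\dots+P_n$ ($P_1,\dots,P_n$ pairwise distinct rational places of $F$) and $G$; the code is $C_{\mathcal L}(D,G)=\{(z(P_1),\dots,z(P_n)) : z\in\mathcal L(G)\}\subseteq\mathbb F_q^n$, its coordinates being indexed by the places in $D$. For a finite separable extension $F'/F$ of such function fields, a place $P$ of $F$ splits completely in $F'$ if exactly $[F':F]$ places of $F'$ lie over it, $d(Q|P)$ denotes the different exponent, and $\mathrm{Diff}(F'/F)=\sum_P\sum_{Q|P}d(Q|P)\,Q$. The lifting of $C_{\mathcal L}(D,G)$ to $F'$ is the AG-code $$\mathfrak L_{F'/F}(C_{\mathcal L}(D,G))=C_{\mathcal L}(\tilde D,\tilde G),\qquad \tilde D=\mathrm{Con}_{F'/F}(D),\quad \tilde G=\mathrm{Con}_{F'/F}(G)+\tfrac12\mathrm{Diff}(F'/F);$$ it is defined if $P_1,\dots,P_n$ split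 completely in $F'$, $\mathrm{Diff}(F'/F)$ is twice a divisor of $F'$, $\tilde D$ is a sum of distinct rational places, and $\tilde D,\tilde G$ are disjoint. Thus $\mathfrak L_{F'/F}$ is a partial operator on AG-codes, each taken with its pair of divisors. Suppose that all different exponents of $F_1/F_0$ and of $F_2/F_1$ are even. Let $C=C_{\mathcal L}(D,G)$ be an AG-code over $F_0$ (for instance an iso-dual one) such that all the places in $D$ split completely in $F_2$. Then $\mathfrak L_{F_1/F_0}(C)$, $\mathfrak L_{F_2/F_1}(\mathfrak L_{F_1/F_0}(C))$ and $\mathfrak L_{F_2/F_0}(C)$ are all defined, and $$\mathfrak L_{F_2/F_1}\bigl(\mathfrak L_{F_1/F_0}(C)\bigr)=\mathfrak L_{F_2/F_0}(C),$$ as an equality of the defining divisors and hence of the codes. Moreover, if $n$ is even and $\deg G>0$, then the standard hypotheses for lifting hold for $C$ in $F_1/F_0$, for $\mathfrak L_{F_1/F_0}(C)$ in $F_2/F_1$, and for $C$ in $F_2/F_0$. For a code $C_{\mathcal L}(D,G)$ over $F$ and an extension $F'/F$ these hypotheses are: the length is even, $\deg G>0$, the places in $D$ split completely in $F'$, and there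 is a finite set $S$ of places of $F$, disjoint from the support of $D$ and containing that of $G$, such that $F'/F$ is unramified outside $S$ and $d(Q|P)$ is even for every $P\in S$ and every place $Q$ of $F'$ over $P$. -/

import Mathlib

open scoped WithZero IntermediateField

namespace AGLift

/-- `F` is an algebraic function field (of one variable) over `k`, and `k` is its full constant
field: `F` is finite over `k(x)` for some `x` transcendental over `k`, and every element of `F`
that is algebraic over `k` lies in `k`. -/
structure IsFunctionField (k F : Type*) [Field k] [Field F] [Algebra k F] : Prop where
  exists_finite : ∃ x : F, Transcendental k x ∧ FiniteDimensional k⟮x⟯ F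
  full_constants : ∀ a : F, IsAlgebraic k a → a ∈ Set.range (algebraMap k F)

/-- A place of `F/k`, given by its valuation ring: a discrete valuation ring that contains `k` and
has `F` as its field of fractions. -/
@[ext]
structure Place (k F : Type*) [Field k] [Field F] [Algebra k F] where
  ring : ValuationSubring F
  const_mem : ∀ c : k, algebraMap k F c ∈ ring
  dvr : IsDiscreteValuationRing ring

namespace Place

section

variable {k F : Type*} [Field k] [Field F] [Algebra k F]

instance (P : Place k F) : IsDiscreteValuationRing P.ring := P.dvr

noncomputable instance (P : Place k F) : Algebra k P.ring :=
  ((algebraMap k F).codRestrict P.ring P.const_mem).toAlgebra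

/-- The normalized discrete valuation of `F` at `P`, in multiplicative notation: `P.val z` is
`exp (-ν_P(z))` for `z ≠ 0`, and `0` for `z = 0`. -/
noncomputable def val (P : Place k F) : Valuation F ℤᵐ⁰ :=
  (IsDiscreteValuationRing.maximalIdeal P.ring).valuation F

/-- The degree of a place: the degree over `k` of its residue field. -/
noncomputable def degree (P : Place k F) : ℕ :=
  Module.finrank k (IsLocalRing.ResidueField P.ring)

/-- A rational place is a place of degree one. -/
def IsRational (P : Place k F) : Prop := P.degree = 1

/-- `z(P) = c`: the function `z` is regular at `P` and its residue class at `P` is the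
constant `c`. -/
def HasValue (P : Place k F) (z : F) (c : k) : Prop :=
  ∃ hz : z ∈ P.ring,
    IsLocalRing.residue P.ring ⟨z, hz⟩ = algebraMap k (IsLocalRing.ResidueField P.ring) c

end

section Extension

variable {k F F' : Type*} [Field k] [Field F] [Field F'] [Algebra k F] [Algebra k F']
  [Algebra F F']

/-- The place `Q` of `F'` lies over the place `P` of `F`: the valuation ring of `P` is the
intersection of `F` with that of `Q`. -/
def LiesOver (Q : Place k F') (P : Place k F) : Prop :=
  Q.ring.comap (algebraMap F F') = P.ring

/-- The ramification index `e(Q|P)` of `Q` lying over `P`: the integer `e` such that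
`ν_Q(x) = e ν_P(x)` for all `x` in `F`. -/
noncomputable def ramificationIndex (Q : Place k F') (P : Place k F) : ℕ :=
  sInf {e : ℕ | ∀ x : F, Q.val (algebraMap F F' x) = P.val x ^ e}

/-- The complementary module of the integral closure `B` in `F'` of the valuation ring `O_P`:
the set of all `z` in `F'` such that `Tr(z B) ⊆ O_P`. -/
noncomputable def complementaryModule (F' : Type*) [Field F'] [Algebra F F'] (P : Place k F) :
    Submodule (integralClosure P.ring F') F' :=
  Submodule.traceDual P.ring F (1 : Submodule (integralClosure P.ring F') F')

/-- The different exponent `d(Q|P)` of `Q` lying over `P`: the largest value of `-ν_Q` on the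
complementary module at `P`, that is `-ν_Q(t)` when `t` generates that module. -/
noncomputable def differentExponent (Q : Place k F') (P : Place k F) : ℕ :=
  sSup {d : ℕ | ∃ z ∈ P.complementaryModule F', Q.val z = WithZero.exp (d : ℤ)}

/-- `P` splits completely in `F'`: there are exactly `[F' : F]` places of `F'` lying over `P`. -/
def SplitsCompletely (F' : Type*) [Field F'] [Algebra k F'] [Algebra F F'] (P : Place k F) :
    Prop :=
  {Q : Place k F' | Q.LiesOver P}.ncard = Module.finrank F F'

end Extension

end Place

/-- Divisors of `F/k`: the free abelian group on the places. -/
abbrev Divisor (k F : Type*) [Field k] [Field F] [Algebra k F] : Type _ := Place k F →₀ ℤ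

namespace Divisor

/-- The degree of a divisor. -/
noncomputable def degree {k F : Type*} [Field k] [Field F] [Algebra k F] (A : Divisor k F) : ℤ :=
  A.sum fun P a => a * (P.degree : ℤ)

/-- The Riemann-Roch space `L(G)`: all `z` in `F` with `z = 0` or `ν_P(z) ≥ -G(P)` for all `P`. -/
noncomputable def riemannRochSpace {k F : Type*} [Field k] [Field F] [Algebra k F]
    (G : Divisor k F) : Submodule k F where
  carrier := {z | ∀ P : Place k F, P.val z ≤ WithZero.exp (G P)}
  zero_mem' P := by simp
  add_mem' ha hb P := (Valuation.map_add_le _ (ha P) (hb P))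
  smul_mem' c z hz P := by
    rw [Algebra.smul_def, map_mul]
    have hc : P.val (algebraMap k F c) ≤ 1 :=
      IsDedekindDomain.HeightOneSpectrum.valuation_le_one
        (IsDiscreteValuationRing.maximalIdeal P.ring) (algebraMap k P.ring c)
    exact mul_le_of_le_one_of_le hc (hz P)

variable {k F F' : Type*} [Field k] [Field F] [Field F'] [Algebra k F] [Algebra k F']
  [Algebra F F']

/-- The conorm map `Div(F) → Div(F')`: the additive extension of
`P ↦ ∑_{Q|P} e(Q|P) Q`. -/
noncomputable def conorm (F' : Type*) [Field F'] [Algebra k F'] [Algebra F F']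
    (A : Divisor k F) : Divisor k F' :=
  A.sum fun P a => a • ∑ᶠ (Q : Place k F') (_ : Q.LiesOver P),
    Finsupp.single Q (Q.ramificationIndex P : ℤ)

/-- The different divisor `∑_P ∑_{Q|P} d(Q|P) Q` of `F'/F`. -/
noncomputable def different (k F F' : Type*) [Field k] [Field F] [Field F'] [Algebra k F]
    [Algebra k F'] [Algebra F F'] : Divisor k F' :=
  ∑ᶠ (P : Place k F), ∑ᶠ (Q : Place k F') (_ : Q.LiesOver P),
    Finsupp.single Q (Q.differentExponent P : ℤ)

end Divisor

/-- An AG-code over the function field `F/k`, given by the divisors that define it: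
`D` is a sum of distinct rational places and `G` is disjoint from `D`. -/
@[ext]
structure AGCode (k F : Type*) [Field k] [Field F] [Algebra k F] where
  D : Divisor k F
  G : Divisor k F
  distinct_rational : ∀ P ∈ D.support, D P = 1 ∧ P.IsRational
  disjoint : Disjoint D.support G.support

namespace AGCode

variable {k F : Type*} [Field k] [Field F] [Algebra k F]

/-- The length of the code: the number of places in `D`. -/
def length (C : AGCode k F) : ℕ := C.D.support.card

/-- The linear code `C_L(D, G) = {(z(P))_P : z ∈ L(G)}`, with coordinates indexed by the places
`P` in `D`. -/
noncomputable def code (C : AGCode k F) : Submodule k (C.D.support → k) where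
  carrier := {c | ∃ z ∈ C.G.riemannRochSpace, ∀ P : C.D.support, P.1.HasValue z (c P)}
  zero_mem' := ⟨0, zero_mem _, fun P => ⟨zero_mem _, by
    rw [Pi.zero_apply, map_zero]; exact map_zero _⟩⟩
  add_mem' := by
    rintro a b ⟨x, hx, hax⟩ ⟨y, hy, hby⟩
    refine ⟨x + y, add_mem hx hy, fun P => ?_⟩
    obtain ⟨h1, h1'⟩ := hax P
    obtain ⟨h2, h2'⟩ := hby P
    refine ⟨add_mem h1 h2, ?_⟩
    rw [Pi.add_apply, map_add, ← h1', ← h2', ← map_add]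
    rfl
  smul_mem' := by
    rintro c a ⟨x, hx, hax⟩
    refine ⟨c • x, Submodule.smul_mem _ c hx, fun P => ?_⟩
    obtain ⟨h1, h1'⟩ := hax P
    have hc : c • x = ((algebraMap k P.1.ring c * ⟨x, h1⟩ : P.1.ring) : F) := by
      rw [Algebra.smul_def]; rfl
    refine ⟨hc ▸ (algebraMap k P.1.ring c * ⟨x, h1⟩ : P.1.ring).2, ?_⟩
    rw [Pi.smul_apply, smul_eq_mul, map_mul, ← h1',
      IsScalarTower.algebraMap_apply k P.1.ring (IsLocalRing.ResidueField P.1.ring),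
      IsLocalRing.ResidueField.algebraMap_eq, ← map_mul]
    congr 1
    exact Subtype.ext hc

/-- The linear code together with its set of coordinates. -/
noncomputable def toCode (C : AGCode k F) :
    Σ s : Finset (Place k F), Submodule k (s → k) := ⟨C.D.support, C.code⟩

/-- `C'` is the lifting to `F'` of the AG-code `C` over `F`: the places in `D` split completely
in `F'`, the different divisor of `F'/F` is twice a divisor `E`, and `C'` is given by
`D' = Con(D)` and `G' = Con(G) + E = Con(G) + (1/2) Diff(F'/F)`. -/
structure IsLifting {F' : Type*} [Field F'] [Algebra k F'] [Algebra F F']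
    (C : AGCode k F) (C' : AGCode k F') : Prop where
  splits : ∀ P ∈ C.D.support, P.SplitsCompletely F'
  D_eq : C'.D = C.D.conorm F'
  G_eq : ∃ E : Divisor k F', 2 • E = Divisor.different k F F' ∧ C'.G = C.G.conorm F' + E

theorem IsLifting.unique {F' : Type*} [Field F'] [Algebra k F'] [Algebra F F']
    {C : AGCode k F} {C₁ C₂ : AGCode k F'} (h₁ : C.IsLifting C₁) (h₂ : C.IsLifting C₂) :
    C₁ = C₂ := by
  obtain ⟨E₁, hE₁, hG₁⟩ := h₁.G_eq
  obtain ⟨E₂, hE₂, hG₂⟩ := h₂.G_eq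
  have hE : E₁ = E₂ := by
    ext Q
    have := DFunLike.congr_fun (hE₁.trans hE₂.symm) Q
    simp only [Finsupp.smul_apply, nsmul_eq_mul, Nat.cast_ofNat] at this
    omega
  exact AGCode.ext (h₁.D_eq.trans h₂.D_eq.symm) (by rw [hG₁, hG₂, hE])

/-- The lifting operator from the AG-codes over `F` to the AG-codes over `F'`, as a partial
function: it is defined at `C` if `C` has a lifting to `F'`. -/
noncomputable def lifting (F' : Type*) [Field F'] [Algebra k F'] [Algebra F F']
    (C : AGCode k F) : Part (AGCode k F') :=
  ⟨∃ C' : AGCode k F', C.IsLifting C', fun h => h.choose⟩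

theorem mem_lifting_iff {F' : Type*} [Field F'] [Algebra k F'] [Algebra F F']
    {C : AGCode k F} {C' : AGCode k F'} : C' ∈ C.lifting F' ↔ C.IsLifting C' := by
  constructor
  · rintro ⟨h, rfl⟩
    exact h.choose_spec
  · intro h
    exact ⟨⟨C', h⟩, (Exists.choose_spec (⟨C', h⟩ : ∃ C', C.IsLifting C')).unique h⟩

/-- The standard hypotheses for lifting an AG-code from `F` to `F'`: the length is even, `G` has
positive degree, the (rational) places in `D` split completely in `F'`, and there is a finite set
`S` of places, disjoint from those in `D` and containing those in `G`, such that `F'/F` is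
unramified outside `S` and has even different exponents over `S`. -/
structure LiftingHypotheses (F' : Type*) [Field F'] [Algebra k F'] [Algebra F F']
    (C : AGCode k F) : Prop where
  even_length : Even C.length
  degree_pos : 0 < C.G.degree
  splits : ∀ P ∈ C.D.support, P.SplitsCompletely F'
  exists_places : ∃ S : Finset (Place k F), Disjoint C.D.support S ∧ C.G.support ⊆ S ∧
    (∀ P ∉ S, ∀ Q : Place k F', Q.LiesOver P → Q.ramificationIndex P = 1) ∧
    ∀ P ∈ S, ∀ Q : Place k F', Q.LiesOver P → Even (Q.differentExponent P)

end AGCode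

end AGLift

/-! Everything rests on two identities: the conorm is transitive, and Diff(F₂/F₀) = Con(Diff(F₁/F₀))
+ Diff(F₂/F₁). Halving the second, which is unambiguous because the divisor group is torsion-free,
gives Con(Con(G) + ½Diff(F₁/F₀)) + ½Diff(F₂/F₁) = Con(G) + ½Diff(F₂/F₀). The codes agree because
their divisors do.

Coefficientwise these are the multiplicativity of e and d(R|P) = e(R|Q) d(Q|P) + d(R|Q)
(`Place.LiesOver.differentExponent_trans`), which comes from transitivity of the trace and also
shows that the exponents of F₂/F₀ are even. To compute with them, the places over P are identified
with the primes of the integral closure of O_P. This is a semilocal Dedekind domain, hence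
principal, so the complementary module has a single generator whose values are the different
exponents.

The liftings are defined because complete splitting passes to both steps of the tower, by counting
against ∑ e f = n, and forces e = f = 1, hence d = 0: places over D stay rational and ½Diff avoids
them. Only finitely many places have d ≠ 0 (`Place.finite_differentExponent_ne_zero`), so Diff is a
genuine divisor; since d = 0 implies e = 1, these places together with the support of G serve as the
set S. -/

namespace AGLift

open IsDedekindDomain

/-! ### Normalized discrete valuations -/

section Valuations

variable {F : Type*} [Field F]

/-- Two surjective valuations with values in `ℤᵐ⁰` that have the same valuation ring are equal. -/
theorem valuation_eq_of_isEquiv {v w : Valuation F ℤᵐ⁰} (hv : Function.Surjective v)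
    (hw : Function.Surjective w) (h : v.IsEquiv w) : v = w := by
  have key : ∀ {v w : Valuation F ℤᵐ⁰}, v.IsEquiv w → ∀ {x : F}, v x = WithZero.exp (-1) →
      ∃ m : ℕ, 0 < m ∧ w x = WithZero.exp (-(m : ℤ)) := by
    intro v w h x hx
    have h0 : w x ≠ 0 := by
      rw [Valuation.ne_zero_iff]; rintro rfl
      rw [map_zero] at hx; exact WithZero.exp_ne_zero hx.symm
    have h1 : w x < 1 := by
      rw [← Valuation.isEquiv_iff_val_lt_one.mp h, hx, ← WithZero.exp_zero, WithZero.exp_lt_exp]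
      norm_num
    rw [← WithZero.exp_log h0, ← WithZero.exp_zero, WithZero.exp_lt_exp] at h1
    refine ⟨(-WithZero.log (w x)).toNat, by omega, ?_⟩
    rw [Int.toNat_of_nonneg (by omega), neg_neg, WithZero.exp_log h0]
  obtain ⟨π, hπ⟩ := hv (WithZero.exp (-1))
  obtain ⟨ρ, hρ⟩ := hw (WithZero.exp (-1))
  obtain ⟨m, hm, hm'⟩ := key h hπ
  obtain ⟨j, hj, hj'⟩ := key h.symm hρ
  -- A unit for v is a unit for w, so comparing exponents gives j * m = 1: the uniformizer π of v is
  -- one of w too, and dividing by powers of π reduces every x to a unit.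
  have h1 : v (ρ / π ^ j) = 1 := by
    rw [map_div₀, map_pow, hπ, hj', ← WithZero.exp_nsmul, ← WithZero.exp_sub, ← WithZero.exp_zero]
    congr 1; simp
  have h2 := (Valuation.isEquiv_iff_val_eq_one.mp h).mp h1
  rw [map_div₀, map_pow, hρ, hm', ← WithZero.exp_nsmul, ← WithZero.exp_sub, ← WithZero.exp_zero,
    WithZero.exp_inj] at h2
  have hm1 : m = 1 := by
    have : (j : ℤ) * m = 1 := by simp at h2; linarith
    have : j * m = 1 := by exact_mod_cast this
    exact Nat.eq_one_of_mul_eq_one_left this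
  subst hm1
  ext x
  rcases eq_or_ne x 0 with rfl | hx
  · simp
  have hvx : v x ≠ 0 := (Valuation.ne_zero_iff v).mpr hx
  have h3 : v (x * π ^ (WithZero.log (v x))) = 1 := by
    rw [map_mul, map_zpow₀, hπ, ← WithZero.exp_zsmul]
    nth_rw 1 [← WithZero.exp_log hvx]
    rw [← WithZero.exp_add, ← WithZero.exp_zero]
    congr 1; simp
  have h4 := (Valuation.isEquiv_iff_val_eq_one.mp h).mp h3
  rw [map_mul, map_zpow₀, hm', ← WithZero.exp_zsmul] at h4
  have h5 := eq_inv_of_mul_eq_one_left h4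
  rw [h5, ← WithZero.exp_neg]
  nth_rw 1 [← WithZero.exp_log hvx]
  congr 1; simp

theorem valuation_eq_of_valuationSubring_eq {v w : Valuation F ℤᵐ⁰} (hv : Function.Surjective v)
    (hw : Function.Surjective w) (h : v.valuationSubring = w.valuationSubring) : v = w :=
  valuation_eq_of_isEquiv hv hw ((Valuation.isEquiv_iff_valuationSubring v w).mpr h)

theorem isDiscreteValuationRing_valuationSubring {v : Valuation F ℤᵐ⁰} {x : F}
    (hx : 1 < v x) : IsDiscreteValuationRing v.valuationSubring := by
  have : v.IsNontrivial := ⟨x, (zero_lt_one.trans hx).ne', hx.ne'⟩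
  infer_instance

end Valuations

/-! ### Places and their valuations -/

namespace Place

section

variable {k F : Type*} [Field k] [Field F] [Algebra k F]

theorem val_surjective (P : Place k F) : Function.Surjective P.val :=
  (IsDiscreteValuationRing.maximalIdeal P.ring).valuation_surjective F

/-- A discrete valuation ring is maximal among the proper valuation subrings of its field, so one
inclusion is enough. The same maximality identifies valuation rings throughout. -/
theorem val_valuationSubring (P : Place k F) : P.val.valuationSubring = P.ring := by
  symm
  refine ValuationSubring.eq_of_le_of_ne_top _ (fun x hx => ?_) ?_
  · exact (IsDiscreteValuationRing.maximalIdeal P.ring).valuation_le_one ⟨x, hx⟩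
  · rw [ne_eq, Valuation.valuationSubring_eq_top_iff, not_not]
    exact inferInstanceAs
      ((IsDiscreteValuationRing.maximalIdeal P.ring).valuation F).IsNontrivial

theorem val_le_one_iff (P : Place k F) {x : F} : P.val x ≤ 1 ↔ x ∈ P.ring := by
  rw [← P.val_valuationSubring, Valuation.mem_valuationSubring_iff]

theorem ring_ne_top (P : Place k F) : P.ring ≠ ⊤ := by
  intro h
  obtain ⟨x, hx⟩ := P.val_surjective (WithZero.exp 1)
  have : x ∈ P.ring := h ▸ ValuationSubring.mem_top x
  rw [← val_le_one_iff, hx, ← WithZero.exp_zero, WithZero.exp_le_exp] at this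
  norm_num at this

theorem val_eq_of_valuationSubring_eq (P : Place k F) {v : Valuation F ℤᵐ⁰}
    (hv : Function.Surjective v) (h : v.valuationSubring = P.ring) : P.val = v :=
  valuation_eq_of_valuationSubring_eq P.val_surjective hv (P.val_valuationSubring.trans h.symm)

theorem eq_of_val_eq {P Q : Place k F} (h : P.val = Q.val) : P = Q := by
  apply Place.ext
  rw [← P.val_valuationSubring, ← Q.val_valuationSubring, h]

/-- The place given by a valuation with values in `ℤᵐ⁰` that is nontrivial, but trivial on the
constants. -/
def ofValuation (k : Type*) [Field k] [Algebra k F] (v : Valuation F ℤᵐ⁰)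
    (hv : ∀ c : k, v (algebraMap k F c) ≤ 1) (h : ∃ x, 1 < v x) : Place k F where
  ring := v.valuationSubring
  const_mem := hv
  dvr := isDiscreteValuationRing_valuationSubring h.choose_spec

theorem val_ofValuation {v : Valuation F ℤᵐ⁰} (hv : ∀ c : k, v (algebraMap k F c) ≤ 1)
    (h : ∃ x, 1 < v x) (hs : Function.Surjective v) : (ofValuation k v hv h).val = v :=
  val_eq_of_valuationSubring_eq _ hs rfl

/-- Valuation rings are integrally closed. The base `A` is arbitrary because it will be a valuation
ring of a subfield, a whole subfield, and k[x]. -/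
theorem mem_ring_of_isIntegral (P : Place k F) {A : Type*} [CommRing A] [Algebra A F]
    (h : ∀ a : A, algebraMap A F a ∈ P.ring) {x : F} (hx : IsIntegral A x) : x ∈ P.ring := by
  let f : A →+* P.ring := (algebraMap A F).codRestrict P.ring h
  obtain ⟨p, hp, hx⟩ := hx
  have : IsIntegral P.ring x := ⟨p.map f, hp.map f, by rw [Polynomial.eval₂_map]; exact hx⟩
  obtain ⟨y, rfl⟩ := IsIntegrallyClosed.isIntegral_iff.mp this
  exact y.2

section Dedekind

variable {R : Type*} [CommRing R] [IsDedekindDomain R] [Algebra R F] [IsFractionRing R F]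

/-- A place that contains a Dedekind domain with the same field of fractions is given by a prime
of it. -/
theorem exists_val_eq (P : Place k F) (h : ∀ r : R, algebraMap R F r ∈ P.ring) :
    ∃ v : HeightOneSpectrum R, P.val = v.valuation F := by
  let f : R →+* P.ring := (algebraMap R F).codRestrict P.ring h
  let p : Ideal R := (IsLocalRing.maximalIdeal P.ring).comap f
  have hmem : ∀ r : R, r ∉ p → (algebraMap R F r)⁻¹ ∈ P.ring := by
    intro r hr
    have hu : IsUnit (f r) := by simpa [p] using hr
    obtain ⟨u, hu⟩ := hu
    have : (algebraMap R F r)⁻¹ = ((u⁻¹ : P.ringˣ) : P.ring) := by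
      have h1 : ((u : P.ring) : F) * ((u⁻¹ : P.ringˣ) : P.ring) = 1 := by
        exact_mod_cast congrArg (Subtype.val) (u.mul_inv)
      have h2 : ((u : P.ring) : F) = algebraMap R F r := by rw [hu]; rfl
      rw [h2] at h1
      exact (eq_inv_of_mul_eq_one_right h1).symm
    rw [this]; exact SetLike.coe_mem _
  have hp0 : p ≠ ⊥ := by
    intro hp
    -- If p = 0, all nonzero elements of R are units of O_P, which then contains Frac R = F.
    apply P.ring_ne_top
    rw [eq_top_iff]
    intro x _
    obtain ⟨a, b, hb, rfl⟩ := IsFractionRing.div_surjective (A := R) x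
    rw [div_eq_mul_inv]
    exact mul_mem (h a) (hmem b (by rw [hp]; simpa using nonZeroDivisors.ne_zero hb))
  refine ⟨⟨p, inferInstance, hp0⟩, P.val_eq_of_valuationSubring_eq
    (HeightOneSpectrum.valuation_surjective F _) ?_⟩
  rw [← HeightOneSpectrum.valuationSubringAtPrime_eq_valuationSubring]
  refine ValuationSubring.eq_of_le_of_ne_top _ ?_ P.ring_ne_top
  rintro x ⟨a, s, hs, rfl⟩
  exact mul_mem (h a) (hmem s hs)

end Dedekind

end

/-- A valuation ring of F' containing F contains everything integral over F, hence all of F'. -/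
theorem comap_ring_ne_top {k F F' : Type*} [Field k] [Field F] [Field F'] [Algebra k F']
    [Algebra F F'] [Algebra.IsAlgebraic F F'] (Q : Place k F') :
    Q.ring.comap (algebraMap F F') ≠ ⊤ := by
  intro h
  apply Q.ring_ne_top
  rw [eq_top_iff]
  intro x _
  exact Q.mem_ring_of_isIntegral
    (fun y => ValuationSubring.mem_comap.mp (h ▸ ValuationSubring.mem_top y))
    (Algebra.IsIntegral.isIntegral (R := F) x)

section Extension

variable {k F F' : Type*} [Field k] [Field F] [Field F'] [Algebra k F] [Algebra k F']
  [Algebra F F']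

theorem LiesOver.mem_iff {Q : Place k F'} {P : Place k F} (h : Q.LiesOver P) {x : F} :
    algebraMap F F' x ∈ Q.ring ↔ x ∈ P.ring := by
  rw [← ValuationSubring.mem_comap, h]

theorem LiesOver.mem_of_isIntegral {Q : Place k F'} {P : Place k F} (h : Q.LiesOver P) {x : F'}
    (hx : IsIntegral P.ring x) : x ∈ Q.ring :=
  Q.mem_ring_of_isIntegral (A := P.ring) (fun y => h.mem_iff.mpr y.2) hx

variable [IsScalarTower k F F']

/-- The place of `F` below a place of the algebraic extension `F'`. -/
noncomputable def below (F : Type*) [Field F] [Algebra k F] [Algebra F F'] [IsScalarTower k F F']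
    [Algebra.IsAlgebraic F F'] (Q : Place k F') : Place k F where
  ring := Q.ring.comap (algebraMap F F')
  const_mem c := by
    rw [ValuationSubring.mem_comap, ← IsScalarTower.algebraMap_apply]
    exact Q.const_mem c
  dvr := by
    have h : Q.ring.comap (algebraMap F F') = (Q.val.comap (algebraMap F F')).valuationSubring := by
      ext x
      rw [ValuationSubring.mem_comap, Valuation.mem_valuationSubring_iff, Valuation.comap_apply,
        val_le_one_iff]
    obtain ⟨x, hx⟩ : ∃ x, x ∉ Q.ring.comap (algebraMap F F') := by
      by_contra! hc
      exact Q.comap_ring_ne_top (eq_top_iff.mpr fun x _ => hc x)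
    rw [h]
    refine isDiscreteValuationRing_valuationSubring (x := x) (not_le.mp fun hle => hx ?_)
    rwa [h]

theorem liesOver_below [Algebra.IsAlgebraic F F'] (Q : Place k F') : Q.LiesOver (Q.below F) := rfl

theorem LiesOver.eq_below [Algebra.IsAlgebraic F F'] {Q : Place k F'} {P : Place k F}
    (h : Q.LiesOver P) : P = Q.below F := Place.ext h.symm

theorem liesOver_iff_eq_below [Algebra.IsAlgebraic F F'] {Q : Place k F'} {P : Place k F} :
    Q.LiesOver P ↔ Q.below F = P := ⟨fun h => h.eq_below.symm, fun h => h ▸ Q.liesOver_below⟩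

end Extension

end Place

end AGLift

namespace AGLift

open IsDedekindDomain

attribute [local instance] FractionRing.liftAlgebra FractionRing.isScalarTower_liftAlgebra

namespace Place

/-! ### The integral closure of a valuation ring in an extension -/

section Integers

variable {k F : Type*} [Field k] [Field F] [Algebra k F]

/-- The integral closure in `F'` of the valuation ring of a place of `F`. -/
abbrev integers (F' : Type*) [Field F'] [Algebra F F'] (P : Place k F) : Subalgebra P.ring F' :=
  integralClosure P.ring F'

variable {F' : Type*} [Field F'] [Algebra F F'] (P : Place k F)

theorem maximalIdeal_ne_bot : IsLocalRing.maximalIdeal P.ring ≠ ⊥ :=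
  IsDiscreteValuationRing.not_a_field P.ring

instance [FiniteDimensional F F'] : IsFractionRing (P.integers F') F' :=
  integralClosure.isFractionRing_of_finite_extension F F'

instance : FaithfulSMul P.ring (P.integers F') :=
  (faithfulSMul_iff_algebraMap_injective _ _).mpr fun _ _ h =>
    Subtype.ext ((algebraMap F F').injective (congrArg Subtype.val h))

theorem finrank_integers [FiniteDimensional F F'] :
    Module.finrank P.ring (P.integers F') = Module.finrank F F' :=
  (IsFractionRing.finrank_eq P.ring F (P.integers F') F').symm

variable [FiniteDimensional F F'] [Algebra.IsSeparable F F']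

instance : IsDedekindDomain (P.integers F') := integralClosure.isDedekindDomain P.ring F F'

instance : Module.Finite P.ring (P.integers F') := IsIntegralClosure.finite P.ring F F' _

instance : Algebra.IsSeparable (FractionRing P.ring) (FractionRing (P.integers F')) := by
  refine Algebra.IsSeparable.of_equiv_equiv
    (FractionRing.algEquiv P.ring F).symm.toRingEquiv
    (FractionRing.algEquiv (P.integers F') F').symm.toRingEquiv ?_
  apply IsLocalization.ringHom_ext (nonZeroDivisors P.ring)
  ext x
  simp only [RingHom.coe_comp, RingHom.coe_coe, AlgEquiv.coe_ringEquiv, Function.comp_apply,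
    AlgEquiv.commutes, ← IsScalarTower.algebraMap_apply]
  rw [IsScalarTower.algebraMap_apply P.ring (P.integers F') F', AlgEquiv.commutes,
    ← IsScalarTower.algebraMap_apply]

instance (v : HeightOneSpectrum (P.integers F')) :
    v.asIdeal.LiesOver (IsLocalRing.maximalIdeal P.ring) := by
  have : (v.asIdeal.under P.ring).IsMaximal := Ideal.IsMaximal.under _ _
  exact ⟨(IsLocalRing.eq_maximalIdeal this).symm⟩

instance (v : HeightOneSpectrum (P.integers F')) :
    v.asIdeal.LiesOver (IsDiscreteValuationRing.maximalIdeal P.ring).asIdeal :=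
  inferInstanceAs (v.asIdeal.LiesOver (IsLocalRing.maximalIdeal P.ring))

instance : Module.Free P.ring (P.integers F') := Module.free_of_finite_type_torsion_free'

/-- The height one primes of the integral closure are the primes over the maximal ideal. -/
def heightOneSpectrumEquiv : HeightOneSpectrum (P.integers F') ≃
    (IsLocalRing.maximalIdeal P.ring).primesOver (P.integers F') where
  toFun v := ⟨v.asIdeal, v.isPrime, inferInstance⟩
  invFun p := ⟨p.1, p.2.1, have := p.2.2; Ideal.ne_bot_of_liesOver_of_ne_bot
    P.maximalIdeal_ne_bot p.1⟩

theorem finite_primesOver :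
    ((IsLocalRing.maximalIdeal P.ring).primesOver (P.integers F')).Finite :=
  IsDedekindDomain.primesOver_finite _ _

instance : Finite (HeightOneSpectrum (P.integers F')) :=
  have := (P.finite_primesOver (F' := F')).to_subtype
  Finite.of_equiv _ P.heightOneSpectrumEquiv.symm

/-- A Dedekind domain with finitely many maximal ideals is principal. This supplies a generator of
the different. -/
instance : IsPrincipalIdealRing (P.integers F') := by
  refine IsPrincipalIdealRing.of_finite_maximals ((P.finite_primesOver (F' := F')).subset ?_)
  intro I hI
  have : I.IsMaximal := hI
  have : (I.under P.ring).IsMaximal := Ideal.IsMaximal.under _ _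
  exact ⟨hI.isPrime, ⟨(IsLocalRing.eq_maximalIdeal this).symm⟩⟩

end Integers

/-! ### Places over P, and the identity ∑ e f = n -/

section PlacesOver

variable {k F F' : Type*} [Field k] [Field F] [Field F'] [Algebra k F] [Algebra k F']
  [Algebra F F'] {P : Place k F}

/-- An x with a simple pole at P determines the exponent, so the infimum in the definition is over a
singleton. -/
theorem ramificationIndex_eq_of_forall {Q : Place k F'} {e : ℕ}
    (h : ∀ x : F, Q.val (algebraMap F F' x) = P.val x ^ e) : Q.ramificationIndex P = e := by
  have : {e : ℕ | ∀ x : F, Q.val (algebraMap F F' x) = P.val x ^ e} = {e} := by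
    ext e'
    refine ⟨fun h' => ?_, fun h' => h' ▸ h⟩
    obtain ⟨x, hx⟩ := P.val_surjective (WithZero.exp 1)
    have := (h' x).symm.trans (h x)
    rw [hx, ← WithZero.exp_nsmul, ← WithZero.exp_nsmul, WithZero.exp_inj] at this
    simpa using this
  rw [ramificationIndex, this, csInf_singleton]

theorem LiesOver.exists_prime [FiniteDimensional F F'] [Algebra.IsSeparable F F']
    {Q : Place k F'} (h : Q.LiesOver P) :
    ∃ v : HeightOneSpectrum (P.integers F'), Q.val = v.valuation F' :=
  Q.exists_val_eq fun r => h.mem_of_isIntegral r.2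

variable [FiniteDimensional F F'] [Algebra.IsSeparable F F']

/-- The prime of the integral closure of the valuation ring at `P` that belongs to a place over
`P`. -/
noncomputable def LiesOver.prime {Q : Place k F'} (h : Q.LiesOver P) :
    HeightOneSpectrum (P.integers F') := h.exists_prime.choose

theorem LiesOver.val_eq {Q : Place k F'} (h : Q.LiesOver P) : Q.val = h.prime.valuation F' :=
  h.exists_prime.choose_spec

theorem LiesOver.prime_eq_of_val_eq {Q : Place k F'} (h : Q.LiesOver P)
    {v : HeightOneSpectrum (P.integers F')} (hv : Q.val = v.valuation F') : h.prime = v := by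
  refine HeightOneSpectrum.eq_of_valuation_isEquiv_valuation (K := F') ?_
  rw [← h.val_eq, hv]

/-- The relative degree of a place over `P`. -/
noncomputable def LiesOver.inertiaDegree {Q : Place k F'} (h : Q.LiesOver P) : ℕ :=
  h.prime.asIdeal.inertiaDeg P.ring

theorem LiesOver.inertiaDegree_pos {Q : Place k F'} (h : Q.LiesOver P) :
    0 < h.inertiaDegree :=
  Ideal.inertiaDeg_pos _ _

theorem LiesOver.ramificationIndex_eq {Q : Place k F'} (h : Q.LiesOver P) :
    Q.ramificationIndex P = h.prime.asIdeal.ramificationIdx P.ring := by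
  apply ramificationIndex_eq_of_forall
  intro x
  have := (IsDiscreteValuationRing.maximalIdeal P.ring).valuation_liesOver F' h.prime x
  rw [h.val_eq, ← Ideal.ramificationIdx'_eq_ramificationIdx (IsLocalRing.maximalIdeal P.ring) _
    P.maximalIdeal_ne_bot]
  exact this.symm

theorem LiesOver.val_algebraMap {Q : Place k F'} (h : Q.LiesOver P) (x : F) :
    Q.val (algebraMap F F' x) = P.val x ^ Q.ramificationIndex P := by
  have := (IsDiscreteValuationRing.maximalIdeal P.ring).valuation_liesOver F' h.prime x
  rw [h.ramificationIndex_eq, h.val_eq, ← Ideal.ramificationIdx'_eq_ramificationIdx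
    (IsLocalRing.maximalIdeal P.ring) _ P.maximalIdeal_ne_bot]
  exact this.symm

theorem LiesOver.ramificationIndex_pos {Q : Place k F'} (h : Q.LiesOver P) :
    0 < Q.ramificationIndex P := by
  rw [h.ramificationIndex_eq]
  exact Ideal.ramificationIdx_pos _ _

theorem LiesOver.one_le_mul {Q : Place k F'} (h : Q.LiesOver P) :
    1 ≤ Q.ramificationIndex P * h.inertiaDegree :=
  Nat.mul_pos h.ramificationIndex_pos h.inertiaDegree_pos

variable [IsScalarTower k F F']

theorem exists_liesOver (v : HeightOneSpectrum (P.integers F')) :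
    ∃ Q : Place k F', Q.LiesOver P ∧ Q.val = v.valuation F' := by
  have hP : ∀ x : F, x ∈ P.ring → v.valuation F' (algebraMap F F' x) ≤ 1 := fun x hx =>
    v.valuation_le_one (algebraMap P.ring (P.integers F') ⟨x, hx⟩)
  have hc : ∀ c : k, v.valuation F' (algebraMap k F' c) ≤ 1 := fun c => by
    rw [IsScalarTower.algebraMap_apply k F F']
    exact hP _ (P.const_mem c)
  obtain ⟨x, hx⟩ := v.valuation_surjective F' (WithZero.exp 1)
  have h1 : ∃ x, 1 < v.valuation F' x := ⟨x, by
    rw [hx, ← WithZero.exp_zero, WithZero.exp_lt_exp]; norm_num⟩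
  refine ⟨ofValuation k _ hc h1, ?_, val_ofValuation hc h1 (v.valuation_surjective F')⟩
  refine (ValuationSubring.eq_of_le_of_ne_top _ (fun x hx => ?_) (comap_ring_ne_top _)).symm
  rw [ValuationSubring.mem_comap, ← val_le_one_iff, val_ofValuation hc h1 (v.valuation_surjective F')]
  exact hP x hx

/-- The places over `P` are the primes of the integral closure of the valuation ring at `P`. -/
noncomputable def liesOverEquiv (F' : Type*) [Field F'] [Algebra k F'] [Algebra F F']
    [IsScalarTower k F F'] [FiniteDimensional F F'] [Algebra.IsSeparable F F'] (P : Place k F) :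
    {Q : Place k F' // Q.LiesOver P} ≃ HeightOneSpectrum (P.integers F') :=
  Equiv.ofBijective (fun Q => Q.2.prime) (by
    constructor
    · rintro ⟨Q, hQ⟩ ⟨R, hR⟩ h
      exact Subtype.ext (eq_of_val_eq (by rw [hQ.val_eq, hR.val_eq]; exact congrArg _ h))
    · intro v
      obtain ⟨Q, hQ, hv⟩ := exists_liesOver v
      exact ⟨⟨Q, hQ⟩, hQ.prime_eq_of_val_eq hv⟩)

theorem finite_liesOver (F' : Type*) [Field F'] [Algebra k F'] [Algebra F F']
    [IsScalarTower k F F'] [FiniteDimensional F F'] [Algebra.IsSeparable F F'] (P : Place k F) :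
    {Q : Place k F' | Q.LiesOver P}.Finite :=
  Set.finite_coe_iff.mp (Finite.of_equiv _ (liesOverEquiv F' P).symm)

/-- The fundamental identity for the integral closure of O_P, whose rank over O_P is [F' : F],
transported along the bijection between places and primes. -/
theorem sum_ramificationIndex_mul_inertiaDegree (P : Place k F)
    [Fintype {Q : Place k F' // Q.LiesOver P}] :
    ∑ Q : {Q : Place k F' // Q.LiesOver P}, Q.1.ramificationIndex P * Q.2.inertiaDegree =
      Module.finrank F F' := by
  have := (P.finite_primesOver (F' := F')).fintype
  rw [← P.finrank_integers, ← Ideal.sum_ramification_inertia_eq_finrank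
    (IsLocalRing.maximalIdeal P.ring)]
  refine Fintype.sum_equiv ((liesOverEquiv F' P).trans P.heightOneSpectrumEquiv) _ _ ?_
  rintro ⟨Q, hQ⟩
  rw [hQ.ramificationIndex_eq]
  rfl

/-- With B the integral closure and q the prime of Q, the map B / q → O_Q / m_Q is an isomorphism
over k; then degrees multiply in k ⊆ O_P / m_P ⊆ B / q. -/
theorem LiesOver.degree_eq {Q : Place k F'} (h : Q.LiesOver P) :
    Q.degree = h.inertiaDegree * P.degree := by
  let m := IsLocalRing.maximalIdeal P.ring
  let q := h.prime.asIdeal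
  have : q.IsMaximal := h.prime.isMaximal
  let f : P.integers F' →+* Q.ring :=
    (algebraMap (P.integers F') F').codRestrict Q.ring fun r => h.mem_of_isIntegral r.2
  let g : P.integers F' →+* IsLocalRing.ResidueField Q.ring := (IsLocalRing.residue Q.ring).comp f
  have hval : ∀ r, Q.val (algebraMap (P.integers F') F' r) = 1 ↔ r ∉ q := fun r => by
    rw [h.val_eq]; exact h.prime.valuation_eq_one_iff_notMem
  have hunit : ∀ x : Q.ring, IsUnit x ↔ Q.val (x : F') = 1 := fun x => by
    have := (IsDiscreteValuationRing.maximalIdeal Q.ring).valuation_eq_one_iff_notMem (K := F')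
      (r := x)
    refine Iff.trans ?_ this.symm
    exact (IsLocalRing.notMem_maximalIdeal (x := x)).symm
  have hker : RingHom.ker g = q := by
    ext r
    rw [RingHom.mem_ker, RingHom.comp_apply, IsLocalRing.residue_eq_zero_iff, ← not_iff_not,
      IsLocalRing.notMem_maximalIdeal, hunit]
    exact hval r
  have hsurj : Function.Surjective g := by
    intro y
    obtain ⟨x, rfl⟩ := IsLocalRing.residue_surjective y
    have hx : h.prime.valuation F' (x : F') ≤ 1 := by
      rw [← h.val_eq, val_le_one_iff]; exact x.2
    -- Write x = n / d with d ∉ q; an inverse d' of d modulo q makes n d' a preimage of the residue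
    -- of x.
    obtain ⟨n, d, hnd⟩ := h.prime.exists_primeCompl_mul_eq_of_integer _ hx
    obtain ⟨d', hd'⟩ := Ideal.Quotient.exists_inv (I := q) (a := Ideal.Quotient.mk q d) (by
      rw [ne_eq, Ideal.Quotient.eq_zero_iff_mem]; exact d.2)
    obtain ⟨d', rfl⟩ := Ideal.Quotient.mk_surjective d'
    have h1 : g (d * d') = 1 := by
      rw [← map_mul, ← map_one (Ideal.Quotient.mk q), Ideal.Quotient.eq, ← hker, RingHom.mem_ker,
        map_sub, map_one, sub_eq_zero] at hd'
      exact hd'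
    have h2 : IsLocalRing.residue Q.ring x * g d = g n := by
      change _ = IsLocalRing.residue Q.ring (f n)
      have : f n = x * f d := Subtype.ext hnd.symm
      rw [this, map_mul]; rfl
    refine ⟨n * d', ?_⟩
    rw [map_mul, ← h2, mul_assoc, ← map_mul, h1, mul_one]
  let e : (P.integers F' ⧸ q) ≃+* IsLocalRing.ResidueField Q.ring :=
    (Ideal.quotEquivOfEq hker.symm).trans (RingHom.quotientKerEquivOfSurjective hsurj)
  have he : ∀ r, e (Ideal.Quotient.mk q r) = g r := fun r => rfl
  let : Field (P.ring ⧸ m) := Ideal.Quotient.field m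
  let : Algebra k (P.ring ⧸ m) := 
    (inferInstance : Algebra k (IsLocalRing.ResidueField P.ring))
  let : Algebra k (P.integers F' ⧸ q) :=
    ((algebraMap (P.ring ⧸ m) (P.integers F' ⧸ q)).comp (algebraMap k (P.ring ⧸ m))).toAlgebra
  have : IsScalarTower k (P.ring ⧸ m) (P.integers F' ⧸ q) := .of_algebraMap_eq fun _ => rfl
  have h1 : Q.degree = Module.finrank k (P.integers F' ⧸ q) := by
    refine (Algebra.finrank_eq_of_equiv_equiv (RingEquiv.refl k) e ?_).symm
    ext c
    change IsLocalRing.residue Q.ring (algebraMap k Q.ring c) =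
      g (algebraMap P.ring (P.integers F') (algebraMap k P.ring c))
    change _ = IsLocalRing.residue Q.ring (f _)
    congr 1
    apply Subtype.ext
    change algebraMap k F' c = algebraMap F F' (algebraMap k F c)
    rw [← IsScalarTower.algebraMap_apply]
  rw [h1, ← Module.finrank_mul_finrank k (P.ring ⧸ m), mul_comm, LiesOver.inertiaDegree,
    Ideal.inertiaDeg_eq_of_isMaximal m q]
  rfl

end PlacesOver

end Place

end AGLift

namespace AGLift

open IsDedekindDomain nonZeroDivisors

attribute [local instance] FractionRing.liftAlgebra FractionRing.isScalarTower_liftAlgebra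

namespace Place

/-! ### The different exponent and ramification -/

section Different

variable {k F F' : Type*} [Field k] [Field F] [Field F'] [Algebra k F]
  [Algebra F F'] {P : Place k F}

theorem mem_complementaryModule {z : F'} : z ∈ P.complementaryModule F' ↔
    ∀ b ∈ P.integers F', Algebra.trace F F' (z * b) ∈ P.ring := by
  rw [complementaryModule, Submodule.mem_traceDual]
  constructor
  · intro h b hb
    obtain ⟨y, hy⟩ := h b (Submodule.mem_one.mpr ⟨⟨b, hb⟩, rfl⟩)
    rw [Algebra.traceForm_apply] at hy
    rw [← hy]; exact y.2
  · intro h b hb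
    obtain ⟨y, rfl⟩ := Submodule.mem_one.mp hb
    exact ⟨⟨_, h _ y.2⟩, rfl⟩

/-- The complementary module is generated by the inverse of a generator of the different. -/
theorem exists_different_eq_span (F' : Type*) [Field F'] [Algebra F F']
    [FiniteDimensional F F'] [Algebra.IsSeparable F F'] (P : Place k F) :
    ∃ t : P.integers F', t ≠ 0 ∧ differentIdeal P.ring (P.integers F') = Ideal.span {t} ∧
      ∀ z : F', z ∈ P.complementaryModule F' ↔ z * t ∈ P.integers F' := by
  obtain ⟨t, ht⟩ := IsPrincipalIdealRing.principal (differentIdeal P.ring (P.integers F'))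
  have ht' : differentIdeal P.ring (P.integers F') = Ideal.span {t} := ht
  have ht0 : t ≠ 0 := by
    rintro rfl
    exact differentIdeal_ne_bot (A := P.ring) (B := P.integers F') (by rw [ht']; simp)
  refine ⟨t, ht0, ht', fun z => ?_⟩
  have h0 : (t : F') ≠ 0 := by simpa using ht0
  have h1 := coeIdeal_differentIdeal P.ring F F' (P.integers F')
  rw [ht', FractionalIdeal.coeIdeal_span_singleton, eq_comm, inv_eq_iff_eq_inv,
    FractionalIdeal.spanSingleton_inv] at h1
  have h2 : P.complementaryModule F' =
      ((FractionalIdeal.dual P.ring F (1 : FractionalIdeal (P.integers F')⁰ F') :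
        FractionalIdeal (P.integers F')⁰ F') : Submodule (P.integers F') F') :=
    (FractionalIdeal.coe_dual_one P.ring F F' (P.integers F')).symm
  rw [h2, FractionalIdeal.mem_coe, h1, FractionalIdeal.mem_spanSingleton]
  constructor
  · rintro ⟨b, rfl⟩
    have : b • (algebraMap (P.integers F') F' t)⁻¹ * (t : F') = b := by
      rw [Algebra.smul_def, mul_assoc]
      change (b : F') * ((t : F')⁻¹ * t) = b
      rw [inv_mul_cancel₀ h0, mul_one]
    rw [this]; exact b.2
  · intro h
    refine ⟨⟨_, h⟩, ?_⟩
    rw [Algebra.smul_def]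
    change z * t * (t : F')⁻¹ = z
    rw [mul_assoc, mul_inv_cancel₀ h0, mul_one]

variable [Algebra k F']

/-- The value -ν_Q(t⁻¹) = ν_Q(t) is attained and bounds all others, so the `sSup` in the definition
is a true maximum, not the default value of an unbounded set. -/
theorem LiesOver.val_eq_exp_neg_differentExponent {Q : Place k F'} (h : Q.LiesOver P) {t : F'}
    (ht0 : t ≠ 0) (ht : t ∈ P.integers F')
    (hM : ∀ z : F', z ∈ P.complementaryModule F' ↔ z * t ∈ P.integers F') :
    Q.val t = WithZero.exp (-(Q.differentExponent P : ℤ)) := by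
  have h0 : Q.val t ≠ 0 := (Valuation.ne_zero_iff _).mpr ht0
  have h1 : Q.val t ≤ 1 := Q.val_le_one_iff.mpr (h.mem_of_isIntegral ht)
  rw [← WithZero.exp_log h0, ← WithZero.exp_zero, WithZero.exp_le_exp] at h1
  obtain ⟨m, hm⟩ := Int.exists_eq_neg_ofNat h1
  have hm' : Q.val t = WithZero.exp (-(m : ℤ)) := by rw [← hm, WithZero.exp_log h0]
  have : IsGreatest {d : ℕ | ∃ z ∈ P.complementaryModule F', Q.val z = WithZero.exp (d : ℤ)} m := by
    refine ⟨⟨t⁻¹, (hM _).mpr ?_, ?_⟩, ?_⟩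
    · rw [inv_mul_cancel₀ ht0]; exact one_mem _
    · rw [map_inv₀, hm', ← WithZero.exp_neg, neg_neg]
    · rintro d ⟨z, hz, hzd⟩
      have h2 := Q.val_le_one_iff.mpr (h.mem_of_isIntegral ((hM z).mp hz))
      rw [map_mul, hzd, hm', ← WithZero.exp_add, ← WithZero.exp_zero, WithZero.exp_le_exp] at h2
      omega
  rw [hm', differentExponent, this.csSup_eq]

variable [FiniteDimensional F F'] [Algebra.IsSeparable F F']

theorem LiesOver.differentExponent_eq_zero_iff {Q : Place k F'} (h : Q.LiesOver P) :
    Q.differentExponent P = 0 ↔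
      ¬ h.prime.asIdeal ∣ differentIdeal P.ring (P.integers F') := by
  obtain ⟨t, ht0, ht, hM⟩ := P.exists_different_eq_span F'
  have h1 := h.val_eq_exp_neg_differentExponent (by simpa using ht0) t.2 hM
  rw [ht, Ideal.dvd_span_singleton, ← h.prime.valuation_eq_one_iff_notMem (K := F'), ← h.val_eq]
  change _ ↔ Q.val (t : F') = 1
  rw [h1, ← WithZero.exp_zero, WithZero.exp_inj]
  omega

theorem LiesOver.exists_map_eq {Q : Place k F'} (h : Q.LiesOver P) :
    ∃ I, h.prime.asIdeal ⊔ I = ⊤ ∧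
      (IsLocalRing.maximalIdeal P.ring).map (algebraMap P.ring (P.integers F')) =
        h.prime.asIdeal ^ Q.ramificationIndex P * I := by
  have h0 : (IsLocalRing.maximalIdeal P.ring).map (algebraMap P.ring (P.integers F')) ≠ ⊥ :=
    Ideal.map_ne_bot_of_ne_bot P.maximalIdeal_ne_bot
  have : h.prime.asIdeal.IsMaximal := h.prime.isMaximal
  rw [h.ramificationIndex_eq, Ideal.IsDedekindDomain.ramificationIdx_eq_normalizedFactors_count
    (IsLocalRing.maximalIdeal P.ring) _ h0]
  exact Ideal.eq_prime_pow_mul_coprime h0 _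

/-- If e ≥ 2 then q² divides m_P B, so q^(2-1) divides the different and d > 0. -/
theorem LiesOver.ramificationIndex_eq_one {Q : Place k F'} (h : Q.LiesOver P)
    (hd : Q.differentExponent P = 0) : Q.ramificationIndex P = 1 := by
  rw [h.differentExponent_eq_zero_iff] at hd
  by_contra he
  have he2 : 2 ≤ Q.ramificationIndex P := by
    have := h.ramificationIndex_pos
    omega
  obtain ⟨I, -, hI⟩ := h.exists_map_eq
  apply hd
  rw [← pow_one h.prime.asIdeal]
  exact pow_sub_one_dvd_differentIdeal P.ring _ 2 P.maximalIdeal_ne_bot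
    (hI ▸ (pow_dvd_pow _ he2).trans (dvd_mul_right _ _))

/-- With f = 1 the residue extension is trivial, hence separable, and an unramified prime with
separable residue extension does not divide the different. -/
theorem LiesOver.differentExponent_eq_zero {Q : Place k F'} (h : Q.LiesOver P)
    (he : Q.ramificationIndex P = 1) (hf : h.inertiaDegree = 1) : Q.differentExponent P = 0 := by
  obtain ⟨I, hI, hI'⟩ := h.exists_map_eq
  rw [he, pow_one] at hI'
  let m := IsLocalRing.maximalIdeal P.ring
  have : h.prime.asIdeal.IsMaximal := h.prime.isMaximal
  rw [LiesOver.inertiaDegree, Ideal.inertiaDeg_eq_of_isMaximal m] at hf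
  rw [h.differentExponent_eq_zero_iff]
  let : Field (P.ring ⧸ m) := Ideal.Quotient.field m
  have : Algebra.IsSeparable (P.ring ⧸ m) (P.integers F' ⧸ h.prime.asIdeal) := by
    refine ⟨fun x => ?_⟩
    obtain ⟨y, rfl⟩ := (Module.Free.bijective_algebraMap_of_finrank_eq_one hf).2 x
    exact isSeparable_algebraMap y
  exact not_dvd_differentIdeal_of_isCoprime_of_isSeparable P.ring _ I
    (Ideal.isCoprime_iff_sup_eq.mpr hI) hI'.symm

end Different

end Place

end AGLift

namespace AGLift

open IsDedekindDomain

namespace Place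

/-! ### Transitivity of ramification indices and different exponents -/

section Tower

variable {k F F' F'' : Type*} [Field k] [Field F] [Field F'] [Field F''] [Algebra k F]
  [Algebra F F'] [Algebra F' F''] [Algebra F F''] [IsScalarTower F F' F''] {P : Place k F}

theorem algebraMap_mem_integers {x : F'} (hx : x ∈ P.integers F') :
    algebraMap F' F'' x ∈ P.integers F'' := by
  have : IsScalarTower P.ring F' F'' := .of_algebraMap_eq fun y =>
    IsScalarTower.algebraMap_apply F F' F'' y
  exact IsIntegral.algebraMap hx

variable [Algebra k F'] {Q : Place k F'}

theorem LiesOver.trans [Algebra k F''] {R : Place k F''} (h' : R.LiesOver Q)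
    (h : Q.LiesOver P) : R.LiesOver P := by
  rw [LiesOver] at *
  rw [← h, ← h', ValuationSubring.comap_comap, ← IsScalarTower.algebraMap_eq]

theorem LiesOver.of_tower [Algebra k F''] {R : Place k F''} (hR : R.LiesOver P)
    (h : R.LiesOver Q) : Q.LiesOver P := by
  rw [LiesOver] at *
  rw [← h, ValuationSubring.comap_comap, ← IsScalarTower.algebraMap_eq, hR]

variable [FiniteDimensional F F'] [Algebra.IsSeparable F F']

/-- Each element of O_Q has a denominator prime to Q; the product of finitely many such denominators
is still a unit at Q. -/
theorem LiesOver.exists_mul_mem_integers (h : Q.LiesOver P) (s : Finset F')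
    (hs : ∀ a ∈ s, a ∈ Q.ring) :
    ∃ b ∈ P.integers F', Q.val b = 1 ∧ ∀ a ∈ s, b * a ∈ P.integers F' := by
  classical
  induction s using Finset.induction_on with
  | empty => exact ⟨1, one_mem _, map_one _, by simp⟩
  | insert a s _ ih =>
    obtain ⟨b, hb, hb1, hbs⟩ := ih fun a ha => hs a (Finset.mem_insert_of_mem ha)
    have ha : h.prime.valuation F' a ≤ 1 := by
      rw [← h.val_eq, val_le_one_iff]; exact hs a (Finset.mem_insert_self _ _)
    obtain ⟨n, d, hnd⟩ := h.prime.exists_primeCompl_mul_eq_of_integer a ha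
    have hd : Q.val (d : P.integers F') = 1 := by
      rw [h.val_eq]; exact h.prime.valuation_eq_one_iff_notMem.mpr d.2
    refine ⟨(d : P.integers F') * b, mul_mem d.1.2 hb, by rw [map_mul, hd, hb1, one_mul], ?_⟩
    intro x hx
    rcases Finset.mem_insert.mp hx with rfl | hx
    · have : (d : P.integers F') * b * x = b * (n : F') := by
        change x * ((d : P.integers F') : F') = (n : F') at hnd
        rw [← hnd]; ring
      rw [this]; exact mul_mem hb n.2
    · rw [mul_assoc]; exact mul_mem d.1.2 (hbs x hx)

/-- O_Q is the localization of the integral closure B at the prime of Q, so c becomes integral over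
B, hence over O_P, after multiplication by some b ∈ B outside that prime. -/
theorem LiesOver.exists_algebraMap_mul_mem_integers (h : Q.LiesOver P) {c : F''}
    (hc : c ∈ Q.integers F'') :
    ∃ b ∈ P.integers F', Q.val b = 1 ∧ algebraMap F' F'' b * c ∈ P.integers F'' := by
  let f : P.integers F' →+* Q.ring :=
    (algebraMap (P.integers F') F').codRestrict Q.ring fun r => h.mem_of_isIntegral r.2
  let : Algebra (P.integers F') Q.ring := f.toAlgebra
  have : IsScalarTower (P.integers F') Q.ring F'' := .of_algebraMap_eq fun _ => rfl
  have hval (r : P.integers F') : Q.val (r : F') = 1 ↔ r ∉ h.prime.asIdeal := by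
    rw [h.val_eq]; exact h.prime.valuation_eq_one_iff_notMem
  have : IsLocalization h.prime.asIdeal.primeCompl Q.ring := by
    refine ⟨fun y => ?_, fun z => ?_, fun {x y} hxy => ⟨1, ?_⟩⟩
    · have hy := (hval y).mpr y.2
      have := (IsDiscreteValuationRing.maximalIdeal Q.ring).valuation_eq_one_iff_notMem (K := F')
        (r := f y)
      exact IsLocalRing.notMem_maximalIdeal.mp (this.mp hy)
    · have hz : h.prime.valuation F' (z : F') ≤ 1 := by
        rw [← h.val_eq, val_le_one_iff]; exact z.2
      obtain ⟨n, d, hnd⟩ := h.prime.exists_primeCompl_mul_eq_of_integer _ hz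
      exact ⟨⟨n, d⟩, Subtype.ext hnd⟩
    · have : x = y := Subtype.ext (congrArg (fun z : Q.ring => (z : F')) hxy)
      rw [this]
  obtain ⟨m, hm⟩ := IsIntegral.exists_multiple_integral_of_isLocalization
    h.prime.asIdeal.primeCompl c hc
  refine ⟨(m : P.integers F'), m.1.2, (hval m).mpr m.2, ?_⟩
  have : IsScalarTower P.ring F' F'' := .of_algebraMap_eq fun y =>
    IsScalarTower.algebraMap_apply F F' F'' y
  have : IsScalarTower P.ring (P.integers F') F'' := .of_algebraMap_eq fun y =>
    IsScalarTower.algebraMap_apply F F' F'' y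
  rw [Submonoid.smul_def, Algebra.smul_def] at hm
  exact isIntegral_trans (R := P.ring) (A := P.integers F') _ hm

variable [Algebra k F''] {R : Place k F''}

theorem LiesOver.ramificationIndex_trans [FiniteDimensional F' F''] [Algebra.IsSeparable F' F'']
    (h' : R.LiesOver Q) (h : Q.LiesOver P) :
    R.ramificationIndex P = Q.ramificationIndex P * R.ramificationIndex Q := by
  apply ramificationIndex_eq_of_forall
  intro x
  rw [IsScalarTower.algebraMap_apply F F' F'', h'.val_algebraMap, h.val_algebraMap, pow_mul]

/-- Different exponents in a tower. -/
theorem LiesOver.differentExponent_trans [FiniteDimensional F' F''] [Algebra.IsSeparable F' F'']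
    (h' : R.LiesOver Q) (h : Q.LiesOver P) :
    R.differentExponent P = R.ramificationIndex Q * Q.differentExponent P +
      R.differentExponent Q := by
  have : FiniteDimensional F F'' := .trans F F' F''
  have : Algebra.IsSeparable F F'' := .trans F F' F''
  have h'' : R.LiesOver P := h'.trans h
  obtain ⟨t, ht0, -, ht⟩ := P.exists_different_eq_span F'
  obtain ⟨s, hs0, -, hs⟩ := P.exists_different_eq_span F''
  obtain ⟨u, hu0, -, hu⟩ := Q.exists_different_eq_span F''
  replace ht0 : (t : F') ≠ 0 := by simpa using ht0
  replace hs0 : (s : F'') ≠ 0 := by simpa using hs0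
  replace hu0 : (u : F'') ≠ 0 := by simpa using hu0
  have htv := h.val_eq_exp_neg_differentExponent ht0 t.2 ht
  have hsv := h''.val_eq_exp_neg_differentExponent hs0 s.2 hs
  have huv := h'.val_eq_exp_neg_differentExponent hu0 u.2 hu
  have hts := h'.val_algebraMap (t : F')
  have ht0' : algebraMap F' F'' t ≠ 0 := by simpa using ht0
  have htr (a : F') (x : F'') : Algebra.trace F' F'' (algebraMap F' F'' a * x) =
      a * Algebra.trace F' F'' x := by
    rw [← Algebra.smul_def, map_smul, smul_eq_mul]
  -- Here s, t, u generate the differents of F''/F and F'/F at P, and of F''/F' at Q. For c integral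
  -- over O_Q, transitivity of the trace puts b Tr(s⁻¹tc) in O_Q, and b is a unit there. This yields
  -- ν_R(s) ≤ ν_R(t) + ν_R(u).
  have h1 : (s : F'')⁻¹ * algebraMap F' F'' t ∈ Q.complementaryModule F'' := by
    rw [mem_complementaryModule]
    intro c hc
    obtain ⟨b, hb, hb1, hbc⟩ := h.exists_algebraMap_mul_mem_integers hc
    have hsM : (s : F'')⁻¹ ∈ P.complementaryModule F'' := by
      rw [hs, inv_mul_cancel₀ hs0]; exact one_mem _
    rw [mem_complementaryModule] at hsM
    have h2 : Algebra.trace F' F'' ((s : F'')⁻¹ * (algebraMap F' F'' b * c)) ∈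
        P.complementaryModule F' := by
      rw [mem_complementaryModule]
      intro a ha
      have := hsM _ (mul_mem hbc (algebraMap_mem_integers (F'' := F'') ha))
      rw [← Algebra.trace_trace (S := F')] at this
      rw [mul_comm, ← htr]
      convert this using 3
      ring
    rw [ht] at h2
    have h3 := h.mem_of_isIntegral h2
    rw [← val_le_one_iff] at h3 ⊢
    have h4 : Algebra.trace F' F'' ((s : F'')⁻¹ * (algebraMap F' F'' b * c)) * t =
        b * Algebra.trace F' F'' ((s : F'')⁻¹ * algebraMap F' F'' t * c) := by
      rw [mul_comm, ← htr, ← htr]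
      congr 1; ring
    rwa [h4, map_mul, hb1, one_mul] at h3
  have h2 : R.val s ≥ R.val (algebraMap F' F'' t) * R.val u := by
    rw [hu] at h1
    have := R.val_le_one_iff.mpr (h'.mem_of_isIntegral h1)
    rw [map_mul, map_mul, map_inv₀, mul_assoc] at this
    have hpos : 0 < R.val s := zero_lt_iff.mpr ((Valuation.ne_zero_iff _).mpr hs0)
    rwa [inv_mul_le_iff₀ hpos, mul_one] at this
  -- The reverse inequality: b u⁻¹ t⁻¹ lies in the complementary module at P for some b that is a
  -- unit at Q. A single b must serve all c, which finite generation over O_P permits.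
  have h3 : R.val s ≤ R.val (algebraMap F' F'' t) * R.val u := by
    have huM : (u : F'')⁻¹ ∈ Q.complementaryModule F'' := by
      rw [hu, inv_mul_cancel₀ hu0]; exact one_mem _
    rw [mem_complementaryModule] at huM
    obtain ⟨G, hG⟩ := Module.Finite.fg_top (R := P.ring) (M := P.integers F'')
    classical
    obtain ⟨b, hb, hb1, hbG⟩ := h.exists_mul_mem_integers
      (G.image fun c : P.integers F'' => Algebra.trace F' F'' ((u : F'')⁻¹ * c)) (by
        intro a ha
        obtain ⟨c, -, rfl⟩ := Finset.mem_image.mp ha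
        refine huM _ ?_
        obtain ⟨p, hp, hc⟩ := c.2
        let f : P.ring →+* Q.ring := ((algebraMap F F').comp P.ring.subtype).codRestrict Q.ring
          fun y => h.mem_iff.mpr y.2
        refine ⟨p.map f, hp.map f, ?_⟩
        rw [Polynomial.eval₂_map]
        convert hc using 2
        ext y
        exact (IsScalarTower.algebraMap_apply F F' F'' y).symm)
    have hall (c : P.integers F'') :
        b * Algebra.trace F' F'' ((u : F'')⁻¹ * c) ∈ P.integers F' := by
      have hc : c ∈ Submodule.span P.ring (G : Set (P.integers F'')) := hG ▸ Submodule.mem_top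
      induction hc using Submodule.span_induction with
      | mem x hx => exact hbG _ (Finset.mem_image_of_mem _ hx)
      | zero => simp
      | add x y _ _ hx hy =>
        rw [AddMemClass.coe_add, mul_add, map_add, mul_add]; exact add_mem hx hy
      | smul a x _ hx =>
        have h4 : (u : F'')⁻¹ * ((a • x : P.integers F'') : F'') =
            algebraMap F' F'' (algebraMap F F' a) * ((u : F'')⁻¹ * x) := by
          rw [← IsScalarTower.algebraMap_apply F F' F'']
          have : ((a • x : P.integers F'') : F'') = algebraMap F F'' a * x :=
            Algebra.smul_def a (x : F'')
          rw [this]; ring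
        rw [h4, htr, mul_left_comm]
        exact mul_mem (isIntegral_algebraMap (R := P.ring) (x := a)) hx
    have h4 : algebraMap F' F'' b * (u : F'')⁻¹ * (algebraMap F' F'' t)⁻¹ ∈
        P.complementaryModule F'' := by
      rw [mem_complementaryModule]
      intro c hc
      have htM : (t : F')⁻¹ ∈ P.complementaryModule F' := by
        rw [ht, inv_mul_cancel₀ ht0]; exact one_mem _
      rw [mem_complementaryModule] at htM
      rw [← Algebra.trace_trace (S := F')]
      convert htM _ (hall ⟨c, hc⟩) using 2
      rw [← mul_assoc, ← htr]
      congr 1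
      rw [map_mul, map_inv₀]
      ring
    rw [hs] at h4
    have h5 := R.val_le_one_iff.mpr (h''.mem_of_isIntegral h4)
    rw [map_mul, map_mul, map_mul, h'.val_algebraMap b, hb1, one_pow, one_mul, map_inv₀, map_inv₀,
      ← mul_inv, inv_mul_le_iff₀, mul_one, mul_comm] at h5
    · exact h5
    · exact zero_lt_iff.mpr (mul_ne_zero ((Valuation.ne_zero_iff _).mpr hu0)
        ((Valuation.ne_zero_iff _).mpr ht0'))
  have h4 := le_antisymm h3 h2
  rw [hsv, hts, htv, huv, ← WithZero.exp_nsmul, ← WithZero.exp_add, WithZero.exp_inj] at h4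
  simp only [nsmul_eq_mul] at h4
  zify
  linarith

end Tower

end Place

end AGLift

namespace AGLift

open IsDedekindDomain Module

namespace Place

/-! ### Finiteness of poles and of the support of the different -/

section Poles

variable {k F : Type*} [Field k] [Field F] [Algebra k F]

/-- Places of a purely inseparable extension are determined by their restriction. -/
theorem below_injective {E : Type*} [Field E] [Algebra k E] [Algebra E F] [IsScalarTower k E F]
    [IsPurelyInseparable E F] : Function.Injective (below E : Place k F → Place k E) := by
  intro P Q h
  obtain ⟨q, hq⟩ := ExpChar.exists E
  have key (P : Place k F) (x : F) (n : ℕ) : x ∈ P.ring ↔ x ^ q ^ n ∈ P.ring := by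
    rw [← val_le_one_iff, ← val_le_one_iff, map_pow,
      pow_le_one_iff (pow_ne_zero n (expChar_ne_zero E q))]
  apply Place.ext
  ext x
  obtain ⟨n, y, hy⟩ := IsPurelyInseparable.pow_mem E q x
  rw [key P x n, key Q x n, ← hy, P.liesOver_below.mem_iff, Q.liesOver_below.mem_iff, h]

open scoped IntermediateField.algebraAdjoinAdjoin in
/-- A function has finitely many poles among the places that are finite with respect to `x`. -/
theorem finite_poles_of_finite_adjoin (x : F) [FiniteDimensional k⟮x⟯ F] (z : F) :
    {P : Place k F | x ∈ P.ring ∧ z ∉ P.ring}.Finite := by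
  let A := Algebra.adjoin k {x}
  let K := k⟮x⟯
  -- F/k(x) may be inseparable. The integral closure of k[x] is taken in the separable part E, and z
  -- is replaced by a power y = z^(q^n) in E with the same poles.
  let E := separableClosure K F
  have : IsPrincipalIdealRing A := by
    have hs : Function.Surjective (Polynomial.aeval x : Polynomial k →ₐ[k] F).rangeRestrict :=
      AlgHom.rangeRestrict_surjective _
    have : IsPrincipalIdealRing (Polynomial.aeval x : Polynomial k →ₐ[k] F).range :=
      .of_surjective _ hs
    rwa [← Algebra.adjoin_singleton_eq_range_aeval] at this
  have : IsDedekindDomain A := inferInstance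
  have : IsScalarTower A K E := .of_algebraMap_eq fun _ => rfl
  have : IsScalarTower k E F := .of_algebraMap_eq fun _ => rfl
  let R := integralClosure A E
  have : IsDedekindDomain R := integralClosure.isDedekindDomain A K E
  have : IsFractionRing R E := integralClosure.isFractionRing_of_finite_extension K E
  obtain ⟨q, hq⟩ := ExpChar.exists E
  obtain ⟨n, y, hy⟩ := IsPurelyInseparable.pow_mem E q z
  have hfin : {P : Place k E | algebraMap k⟮x⟯ E (IntermediateField.AdjoinSimple.gen k x) ∈ P.ring ∧
      y ∉ P.ring}.Finite := by
    have hex (P : {P : Place k E | algebraMap k⟮x⟯ E (IntermediateField.AdjoinSimple.gen k x) ∈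
        P.ring ∧ y ∉ P.ring}) : ∃ v : HeightOneSpectrum R, P.1.val = v.valuation E := by
      refine P.1.exists_val_eq fun r => P.1.mem_ring_of_isIntegral (A := A) (fun a => ?_) r.2
      obtain ⟨a, ha⟩ := a
      induction ha using Algebra.adjoin_induction with
      | mem a ha => obtain rfl := ha; exact P.2.1
      | algebraMap c => exact P.1.const_mem c
      | add a b ha hb h1 h2 => exact add_mem h1 h2
      | mul a b ha hb h1 h2 => exact mul_mem h1 h2
    choose v hv using hex
    -- Places of E regular at x are primes of the Dedekind domain R, and y has poles at only
    -- finitely many primes.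
    have hS := HeightOneSpectrum.Support.finite R y
    have := hS.to_subtype
    rw [← Set.finite_coe_iff]
    refine Finite.of_injective (β := HeightOneSpectrum.Support R y) (fun P => ⟨v P, ?_⟩) ?_
    · rw [HeightOneSpectrum.Support, Set.mem_ofPred_eq, ← hv, ← not_le, val_le_one_iff]
      exact P.2.2
    · intro P Q h
      exact Subtype.ext (eq_of_val_eq (by
        rw [hv, hv]; exact congrArg (HeightOneSpectrum.valuation E) (congrArg Subtype.val h)))
  refine (hfin.preimage (below_injective (E := E)).injOn).subset ?_
  rintro P ⟨hx, hz⟩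
  refine ⟨P.liesOver_below.mem_iff.mp hx, fun h => hz ?_⟩
  rw [← P.liesOver_below.mem_iff, hy, ← val_le_one_iff, map_pow,
    pow_le_one_iff (pow_ne_zero n (expChar_ne_zero E q)), val_le_one_iff] at h
  exact h

/-- A function has finitely many poles. -/
theorem finite_poles (hF : IsFunctionField k F) (z : F) : {P : Place k F | z ∉ P.ring}.Finite := by
  obtain ⟨x, -, hx⟩ := hF.exists_finite
  have hx' : FiniteDimensional k⟮x⁻¹⟯ F := by
    have : k⟮x⁻¹⟯ = k⟮x⟯ := by
      apply le_antisymm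
      · rw [IntermediateField.adjoin_simple_le_iff]
        exact inv_mem (IntermediateField.mem_adjoin_simple_self k x)
      · rw [IntermediateField.adjoin_simple_le_iff]
        simpa using inv_mem (IntermediateField.mem_adjoin_simple_self k x⁻¹)
    rwa [this]
  refine ((finite_poles_of_finite_adjoin x z).union (finite_poles_of_finite_adjoin x⁻¹ z)).subset ?_
  intro P hP
  rcases P.ring.mem_or_inv_mem x with h | h
  · exact Or.inl ⟨h, hP⟩
  · exact Or.inr ⟨h, hP⟩

variable {F' : Type*} [Field F'] [Algebra F F']

/-- Wherever the coefficients of the minimal polynomial of w are regular, w is integral; each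
coefficient has finitely many poles. -/
theorem finite_notMem_integers [FiniteDimensional F F'] (hF : IsFunctionField k F) (w : F') :
    {P : Place k F | w ∉ P.integers F'}.Finite := by
  refine ((minpoly F w).support.finite_toSet.biUnion fun i _ =>
    finite_poles hF ((minpoly F w).coeff i)).subset fun P hP => ?_
  by_contra hc
  apply hP
  simp only [Set.mem_iUnion, Set.mem_ofPred_eq, not_exists, not_not, Finset.mem_coe] at hc
  have hl : minpoly F w ∈ Polynomial.lifts (algebraMap P.ring F) := by
    rw [Polynomial.lifts_iff_coeff_lifts]
    intro i
    by_cases hi : i ∈ (minpoly F w).support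
    · exact ⟨⟨_, hc i hi⟩, rfl⟩
    · rw [Polynomial.notMem_support_iff.mp hi]
      exact ⟨0, map_zero _⟩
  obtain ⟨p, hp, -, hpm⟩ := Polynomial.lifts_and_natDegree_eq_and_monic hl
    (minpoly.monic (Algebra.IsIntegral.isIntegral w))
  refine ⟨p, hpm, ?_⟩
  have := minpoly.aeval F w
  rwa [← hp, Polynomial.aeval_map_algebraMap] at this

/-- Almost all different exponents vanish. -/
theorem finite_differentExponent_ne_zero (F' : Type*) [Field F'] [Algebra F F'] [Algebra k F']
    [FiniteDimensional F F'] [Algebra.IsSeparable F F'] (hF : IsFunctionField k F) :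
    {P : Place k F | ∃ Q : Place k F', Q.LiesOver P ∧ Q.differentExponent P ≠ 0}.Finite := by
  classical
  let b := Module.finBasis F F'
  refine ((Set.finite_iUnion fun i => finite_notMem_integers hF (b i)).union
    (Set.finite_iUnion fun i => finite_notMem_integers hF (b.traceDual i))).subset ?_
  rintro P ⟨Q, h, hd⟩
  by_contra hc
  simp only [Set.mem_union, Set.mem_iUnion, Set.mem_ofPred_eq, not_or, not_exists, not_not] at hc
  apply hd
  obtain ⟨t, ht0, -, ht⟩ := P.exists_different_eq_span F'
  replace ht0 : (t : F') ≠ 0 := by simpa using ht0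
  have htM : (t : F')⁻¹ ∈ P.complementaryModule F' := by
    rw [ht, inv_mul_cancel₀ ht0]; exact one_mem _
  -- Where a basis b and its trace dual b* are both integral, z = ∑ Tr(z bᵢ) bᵢ* is integral for
  -- every z in the complementary module.
  have hti : (t : F')⁻¹ ∈ P.integers F' := by
    rw [mem_complementaryModule] at htM
    rw [← b.traceDual.sum_repr (t : F')⁻¹]
    refine sum_mem fun i _ => ?_
    rw [Basis.traceDual_repr_apply, Algebra.traceForm_apply, Algebra.smul_def]
    exact mul_mem (isIntegral_algebraMap (R := P.ring) (x := ⟨_, htM _ (hc.1 i)⟩)) (hc.2 i)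
  have h1 := Q.val_le_one_iff.mpr (h.mem_of_isIntegral hti)
  rw [map_inv₀, h.val_eq_exp_neg_differentExponent ht0 t.2 ht, ← WithZero.exp_neg,
    ← WithZero.exp_zero, WithZero.exp_le_exp] at h1
  omega

end Poles

end Place

end AGLift

namespace AGLift

namespace Place

/-! ### Complete splitting -/

section Splitting

variable {k F F' : Type*} [Field k] [Field F] [Field F'] [Algebra k F] [Algebra k F']
  [Algebra F F'] [IsScalarTower k F F'] [FiniteDimensional F F'] [Algebra.IsSeparable F F']

theorem mem_toFinset_finite_liesOver {P : Place k F} {Q : Place k F'} :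
    Q ∈ (finite_liesOver F' P).toFinset ↔ Q.LiesOver P := by
  rw [Set.Finite.mem_toFinset, Set.mem_ofPred_eq]

theorem ncard_liesOver (P : Place k F) :
    {Q : Place k F' | Q.LiesOver P}.ncard = (finite_liesOver F' P).toFinset.card :=
  Set.ncard_eq_toFinset_card _ _

theorem sum_liesOver_ramificationIndex_mul_degree (P : Place k F) :
    ∑ Q ∈ (finite_liesOver F' P).toFinset, Q.ramificationIndex P * Q.degree =
      Module.finrank F F' * P.degree := by
  have : Finite {Q : Place k F' // Q.LiesOver P} := (finite_liesOver F' P).to_subtype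
  have := Fintype.ofFinite {Q : Place k F' // Q.LiesOver P}
  rw [← sum_ramificationIndex_mul_inertiaDegree P, Finset.sum_mul,
    Finset.sum_subtype _ fun Q => mem_toFinset_finite_liesOver (Q := Q) (P := P)]
  refine Finset.sum_congr rfl fun Q _ => ?_
  rw [Q.2.degree_eq, mul_assoc]

theorem sum_liesOver_one (P : Place k F) [Fintype {Q : Place k F' // Q.LiesOver P}] :
    ∑ _Q : {Q : Place k F' // Q.LiesOver P}, 1 = (finite_liesOver F' P).toFinset.card := by
  rw [Finset.card_eq_sum_ones, Finset.sum_subtype _ fun Q =>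
    mem_toFinset_finite_liesOver (Q := Q) (P := P)]

theorem card_liesOver_le (P : Place k F) :
    (finite_liesOver F' P).toFinset.card ≤ Module.finrank F F' := by
  have : Finite {Q : Place k F' // Q.LiesOver P} := (finite_liesOver F' P).to_subtype
  have := Fintype.ofFinite {Q : Place k F' // Q.LiesOver P}
  rw [← sum_ramificationIndex_mul_inertiaDegree P, ← sum_liesOver_one P]
  exact Finset.sum_le_sum fun Q _ => Q.2.one_le_mul

theorem SplitsCompletely.card_liesOver {P : Place k F} (hP : P.SplitsCompletely F') :
    (finite_liesOver F' P).toFinset.card = Module.finrank F F' := by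
  rw [← ncard_liesOver]; exact hP

/-- There are n terms e f ≥ 1 with sum n, so every one equals 1. -/
theorem SplitsCompletely.eq_one {P : Place k F} (hP : P.SplitsCompletely F') {Q : Place k F'}
    (h : Q.LiesOver P) : Q.ramificationIndex P = 1 ∧ h.inertiaDegree = 1 := by
  have : Finite {Q : Place k F' // Q.LiesOver P} := (finite_liesOver F' P).to_subtype
  have := Fintype.ofFinite {Q : Place k F' // Q.LiesOver P}
  have h1 := hP.card_liesOver
  rw [← sum_ramificationIndex_mul_inertiaDegree P, ← sum_liesOver_one P,
    Finset.sum_eq_sum_iff_of_le fun Q _ => Q.2.one_le_mul] at h1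
  exact ⟨Nat.eq_one_of_mul_eq_one_right (h1 ⟨Q, h⟩ (Finset.mem_univ _)).symm,
    Nat.eq_one_of_mul_eq_one_left (h1 ⟨Q, h⟩ (Finset.mem_univ _)).symm⟩

theorem SplitsCompletely.degree_eq {P : Place k F} (hP : P.SplitsCompletely F') {Q : Place k F'}
    (h : Q.LiesOver P) : Q.degree = P.degree := by
  rw [h.degree_eq, (hP.eq_one h).2, one_mul]

theorem SplitsCompletely.differentExponent_eq_zero {P : Place k F} (hP : P.SplitsCompletely F')
    {Q : Place k F'} (h : Q.LiesOver P) : Q.differentExponent P = 0 :=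
  h.differentExponent_eq_zero (hP.eq_one h).1 (hP.eq_one h).2

variable {F'' : Type*} [Field F''] [Algebra k F''] [Algebra F' F''] [Algebra F F'']
  [IsScalarTower F F' F''] [IsScalarTower k F' F''] [IsScalarTower k F F'']
  [FiniteDimensional F' F''] [Algebra.IsSeparable F' F'']
  [FiniteDimensional F F''] [Algebra.IsSeparable F F'']

theorem card_liesOver_tower (P : Place k F) :
    (finite_liesOver F'' P).toFinset.card =
      ∑ Q ∈ (finite_liesOver F' P).toFinset, (finite_liesOver F'' Q).toFinset.card := by
  classical
  rw [Finset.card_eq_sum_card_fiberwise (f := fun R : Place k F'' => R.below F')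
    (t := (finite_liesOver F' P).toFinset)]
  · refine Finset.sum_congr rfl fun Q hQ => ?_
    congr 1
    ext R
    rw [Finset.mem_filter, mem_toFinset_finite_liesOver, mem_toFinset_finite_liesOver,
      ← liesOver_iff_eq_below]
    exact ⟨fun h => h.2, fun h => ⟨h.trans (mem_toFinset_finite_liesOver.mp hQ), h⟩⟩
  · intro R hR
    rw [Finset.mem_coe, mem_toFinset_finite_liesOver] at hR ⊢
    exact hR.of_tower R.liesOver_below

/-- A place that splits completely in a tower splits completely at every step. -/
theorem SplitsCompletely.of_tower {P : Place k F} (hP : P.SplitsCompletely F'') :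
    P.SplitsCompletely F' ∧ ∀ Q : Place k F', Q.LiesOver P → Q.SplitsCompletely F'' := by
  have h1 := hP.card_liesOver
  rw [card_liesOver_tower (F' := F'), ← Module.finrank_mul_finrank F F' F''] at h1
  have hpos : 0 < Module.finrank F' F'' := Module.finrank_pos
  -- Each Q has at most [F'' : F'] places above it and P at most [F' : F]; the total reaches the
  -- product of the bounds, so each bound is attained.
  have h2 : ∑ Q ∈ (finite_liesOver F' P).toFinset, (finite_liesOver F'' Q).toFinset.card ≤
      (finite_liesOver F' P).toFinset.card * Module.finrank F' F'' := by
    rw [← smul_eq_mul]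
    exact Finset.sum_le_card_nsmul _ _ _ fun Q _ => card_liesOver_le Q
  have h3 : (finite_liesOver F' P).toFinset.card = Module.finrank F F' := by
    refine le_antisymm (card_liesOver_le P) ?_
    exact Nat.le_of_mul_le_mul_right (h1.symm.trans_le h2) hpos
  rw [← h3, ← smul_eq_mul, ← Finset.sum_const, Finset.sum_eq_sum_iff_of_le
    fun Q _ => card_liesOver_le Q] at h1
  refine ⟨(ncard_liesOver P).trans h3, fun Q hQ => ?_⟩
  exact (ncard_liesOver Q).trans (h1 Q (mem_toFinset_finite_liesOver.mpr hQ))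

end Splitting

end Place

/-! ### Degrees, conorms and the different divisor -/

namespace Divisor

section Degree

variable {k F : Type*} [Field k] [Field F] [Algebra k F]

/-- The degree of divisors as a homomorphism. -/
noncomputable def degreeHom (k F : Type*) [Field k] [Field F] [Algebra k F] : Divisor k F →+ ℤ where
  toFun := degree
  map_zero' := Finsupp.sum_zero_index
  map_add' _ _ := Finsupp.sum_add_index' (fun _ => zero_mul _) fun _ _ _ => add_mul _ _ _

theorem degreeHom_apply (A : Divisor k F) : degreeHom k F A = A.degree := rfl

theorem degreeHom_single (P : Place k F) (a : ℤ) :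
    degreeHom k F (Finsupp.single P a) = a * P.degree :=
  Finsupp.sum_single_index (h := fun (P : Place k F) (a : ℤ) => a * (P.degree : ℤ)) (zero_mul _)

theorem degree_nonneg {A : Divisor k F} (hA : ∀ P, 0 ≤ A P) : 0 ≤ A.degree :=
  Finset.sum_nonneg fun P _ => mul_nonneg (hA P) (Int.natCast_nonneg _)

end Degree

section Conorm

variable {k F F' : Type*} [Field k] [Field F] [Field F'] [Algebra k F] [Algebra k F']
  [Algebra F F'] [IsScalarTower k F F'] [FiniteDimensional F F'] [Algebra.IsSeparable F F']

open Place

theorem finsum_liesOver (P : Place k F) (f : Place k F' → Divisor k F') :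
    ∑ᶠ (Q : Place k F') (_ : Q.LiesOver P), f Q =
      ∑ Q ∈ (finite_liesOver F' P).toFinset, f Q :=
  finsum_mem_eq_finite_toFinset_sum f (finite_liesOver F' P)

theorem finsum_liesOver_single_apply (P : Place k F) (c : Place k F' → ℤ) (R : Place k F')
    [Decidable (R.LiesOver P)] :
    (∑ᶠ (Q : Place k F') (_ : Q.LiesOver P), Finsupp.single Q (c Q) : Divisor k F') R =
      if R.LiesOver P then c R else 0 := by
  classical
  rw [finsum_liesOver, Finsupp.finsetSum_apply]
  simp only [Finsupp.single_apply, Finset.sum_ite_eq', mem_toFinset_finite_liesOver]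

/-- Q lies over one place only, so one term of the sum survives. Divisor identities become pointwise
ones. -/
theorem conorm_apply (A : Divisor k F) {P : Place k F} {Q : Place k F'} (h : Q.LiesOver P) :
    A.conorm F' Q = Q.ramificationIndex P * A P := by
  classical
  rw [conorm, Finsupp.sum, Finsupp.finsetSum_apply, Finset.sum_eq_single P]
  · rw [Finsupp.smul_apply, finsum_liesOver_single_apply, if_pos h, smul_eq_mul, mul_comm]
  · intro P' _ hne
    rw [Finsupp.smul_apply, finsum_liesOver_single_apply, if_neg, smul_zero]
    intro h'
    exact hne (h'.eq_below.trans h.eq_below.symm)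
  · intro hP
    rw [Finsupp.notMem_support_iff.mp hP, zero_smul, Finsupp.zero_apply]

theorem conorm_add (A B : Divisor k F) : (A + B).conorm F' = A.conorm F' + B.conorm F' := by
  ext Q
  have h := Q.liesOver_below (F := F)
  rw [Finsupp.add_apply, conorm_apply _ h, conorm_apply _ h, conorm_apply _ h, Finsupp.add_apply,
    mul_add]

theorem conorm_nsmul (n : ℕ) (A : Divisor k F) : (n • A).conorm F' = n • A.conorm F' := by
  ext Q
  have h := Q.liesOver_below (F := F)
  rw [Finsupp.smul_apply, conorm_apply _ h, conorm_apply _ h, Finsupp.smul_apply, mul_smul_comm]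

theorem degree_conorm (A : Divisor k F) :
    (A.conorm F').degree = Module.finrank F F' * A.degree := by
  rw [conorm, ← degreeHom_apply, Finsupp.sum, map_sum, degree, Finsupp.sum, Finset.mul_sum]
  refine Finset.sum_congr rfl fun P _ => ?_
  have := sum_liesOver_ramificationIndex_mul_degree (F' := F') P
  rw [map_zsmul, finsum_liesOver, map_sum, smul_eq_mul, mul_left_comm]
  congr 1
  rw [← Nat.cast_mul, ← this, Nat.cast_sum]
  exact Finset.sum_congr rfl fun Q _ => by rw [degreeHom_single, Nat.cast_mul]

/-- A `finsum` of infinite support would be 0; finiteness of the places with d ≠ 0 excludes that. -/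
theorem different_apply (hF : IsFunctionField k F) {P : Place k F} {Q : Place k F'}
    (h : Q.LiesOver P) : different k F F' Q = Q.differentExponent P := by
  classical
  have hfin := finite_differentExponent_ne_zero F' hF
  rw [different, finsum_eq_sum_of_support_subset (s := hfin.toFinset)]
  · rw [Finsupp.finsetSum_apply, Finset.sum_eq_single P]
    · rw [finsum_liesOver_single_apply, if_pos h]
    · intro P' _ hne
      rw [finsum_liesOver_single_apply, if_neg]
      intro h'
      exact hne (h'.eq_below.trans h.eq_below.symm)
    · intro hP
      rw [finsum_liesOver_single_apply, if_pos h]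
      by_contra hd
      exact hP (hfin.mem_toFinset.mpr ⟨Q, h, by exact_mod_cast hd⟩)
  · intro P' hP'
    rw [Set.Finite.coe_toFinset]
    obtain ⟨Q', hQ'⟩ := Finsupp.ne_iff.mp hP'
    rw [finsum_liesOver_single_apply, Finsupp.zero_apply] at hQ'
    by_cases h' : Q'.LiesOver P'
    · rw [if_pos h'] at hQ'
      exact ⟨Q', h', by exact_mod_cast hQ'⟩
    · rw [if_neg h'] at hQ'
      exact absurd rfl hQ'

variable {F'' : Type*} [Field F''] [Algebra k F''] [Algebra F' F''] [Algebra F F'']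
  [IsScalarTower F F' F''] [IsScalarTower k F' F''] [IsScalarTower k F F'']
  [FiniteDimensional F' F''] [Algebra.IsSeparable F' F'']
  [FiniteDimensional F F''] [Algebra.IsSeparable F F'']

theorem conorm_conorm (A : Divisor k F) : (A.conorm F').conorm F'' = A.conorm F'' := by
  ext R
  have h' := R.liesOver_below (F := F')
  have h := (R.below F').liesOver_below (F := F)
  rw [conorm_apply _ h', conorm_apply _ h, conorm_apply _ (h'.trans h),
    h'.ramificationIndex_trans h, Nat.cast_mul]
  ring

/-- The different divisor of a tower. -/
theorem different_tower (hF : IsFunctionField k F) (hF' : IsFunctionField k F') :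
    different k F F'' = (different k F F').conorm F'' + different k F' F'' := by
  ext R
  have h' := R.liesOver_below (F := F')
  have h := (R.below F').liesOver_below (F := F)
  rw [Finsupp.add_apply, conorm_apply _ h', different_apply hF h, different_apply hF' h',
    different_apply hF (h'.trans h), h'.differentExponent_trans h]
  push_cast
  rfl

end Conorm

end Divisor

/-! ### Lifting AG-codes -/

namespace AGCode

open Place Divisor

variable {k F F' : Type*} [Field k] [Field F] [Field F'] [Algebra k F] [Algebra k F']
  [Algebra F F'] [IsScalarTower k F F'] [FiniteDimensional F F'] [Algebra.IsSeparable F F']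
  {C : AGCode k F}

theorem mem_support_conorm {A : Divisor k F} {P : Place k F} {Q : Place k F'}
    (h : Q.LiesOver P) : Q ∈ (A.conorm F').support ↔ P ∈ A.support := by
  have := h.ramificationIndex_pos
  rw [Finsupp.mem_support_iff, Finsupp.mem_support_iff, conorm_apply _ h]
  simp [this.ne']

/-- A code can be lifted if its places split completely and all different exponents are even. -/
theorem exists_isLifting (hF : IsFunctionField k F)
    (hd : ∀ (P : Place k F) (Q : Place k F'), Q.LiesOver P → Even (Q.differentExponent P))
    (hs : ∀ P ∈ C.D.support, P.SplitsCompletely F') :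
    ∃ C' : AGCode k F', C.IsLifting C' := by
  -- Integer division is exact here, since all coefficients are even.
  let E : Divisor k F' := (different k F F').mapRange (· / 2) (by norm_num)
  have hE (Q : Place k F') : 2 * E Q = Q.differentExponent (Q.below F) := by
    have h := Q.liesOver_below (F := F)
    change 2 * (different k F F' Q / 2) = _
    rw [different_apply hF h]
    obtain ⟨m, hm⟩ := hd _ _ h
    omega
  refine ⟨⟨C.D.conorm F', C.G.conorm F' + E, fun Q hQ => ?_, ?_⟩, hs, rfl, E, ?_, rfl⟩
  · have h := Q.liesOver_below (F := F)
    have hP := (mem_support_conorm h).mp hQ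
    obtain ⟨h1, h2⟩ := C.distinct_rational _ hP
    refine ⟨?_, ?_⟩
    · rw [conorm_apply _ h, h1, ((hs _ hP).eq_one h).1, Nat.cast_one, one_mul]
    · rw [IsRational, (hs _ hP).degree_eq h]; exact h2
  · rw [Finset.disjoint_left]
    intro Q hQ hQ'
    have h := Q.liesOver_below (F := F)
    have hP := (mem_support_conorm h).mp hQ
    have h1 := Finset.disjoint_left.mp C.disjoint hP
    rw [Finsupp.notMem_support_iff] at h1
    -- Over a place of D complete splitting gives d = 0, so E vanishes at Q, as does Con(G).
    have h2 := hE Q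
    rw [(hs _ hP).differentExponent_eq_zero h] at h2
    rw [Finsupp.mem_support_iff, Finsupp.add_apply, conorm_apply _ h, h1] at hQ'
    omega
  · ext Q
    rw [different_apply hF Q.liesOver_below, ← hE, Finsupp.smul_apply]
    simp

theorem IsLifting.even_length {C' : AGCode k F'} (h : C.IsLifting C') (he : Even C.length) :
    Even C'.length := by
  classical
  have : C'.length = C.length * Module.finrank F F' := by
    rw [length, length, ← smul_eq_mul, ← Finset.sum_const, h.D_eq,
      Finset.card_eq_sum_card_fiberwise (f := fun Q : Place k F' => Q.below F) (t := C.D.support)]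
    · refine Finset.sum_congr rfl fun P hP => ?_
      rw [← (h.splits P hP).card_liesOver]
      congr 1
      ext Q
      rw [Finset.mem_filter, mem_toFinset_finite_liesOver, ← liesOver_iff_eq_below]
      exact ⟨fun h => h.2, fun h => ⟨(mem_support_conorm h).mpr hP, h⟩⟩
    · intro Q hQ
      exact (mem_support_conorm Q.liesOver_below).mp hQ
  rw [this]
  exact he.mul_right _

/-- The new degree is [F' : F] deg G + deg E, and E is effective. -/
theorem IsLifting.degree_pos (hF : IsFunctionField k F) {C' : AGCode k F'} (h : C.IsLifting C')
    (hG : 0 < C.G.degree) : 0 < C'.G.degree := by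
  obtain ⟨E, hE, hG'⟩ := h.G_eq
  rw [hG', ← degreeHom_apply, map_add, degreeHom_apply, degreeHom_apply, degree_conorm]
  have h1 : 0 ≤ E.degree := degree_nonneg fun Q => by
    have := DFunLike.congr_fun hE Q
    rw [different_apply hF Q.liesOver_below, Finsupp.smul_apply] at this
    simp only [nsmul_eq_mul, Nat.cast_ofNat] at this
    omega
  have h2 : 0 < (Module.finrank F F' : ℤ) := by exact_mod_cast Module.finrank_pos
  have := mul_pos h2 hG
  omega

/-- S consists of the places with some d ≠ 0 and the support of G. It misses D because d = 0 over
split places, and outside it d = 0 gives e = 1. -/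
theorem liftingHypotheses (hF : IsFunctionField k F)
    (hd : ∀ (P : Place k F) (Q : Place k F'), Q.LiesOver P → Even (Q.differentExponent P))
    (hs : ∀ P ∈ C.D.support, P.SplitsCompletely F') (he : Even C.length)
    (hG : 0 < C.G.degree) : C.LiftingHypotheses F' := by
  classical
  have hfin := finite_differentExponent_ne_zero F' hF
  refine ⟨he, hG, hs, hfin.toFinset ∪ C.G.support, ?_, Finset.subset_union_right, ?_,
    fun P _ Q h => hd P Q h⟩
  · rw [Finset.disjoint_union_right]
    refine ⟨Finset.disjoint_left.mpr fun P hP hP' => ?_, C.disjoint⟩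
    obtain ⟨Q, h, hne⟩ := hfin.mem_toFinset.mp hP'
    exact hne ((hs P hP).differentExponent_eq_zero h)
  · intro P hP Q h
    rw [Finset.mem_union, not_or, hfin.mem_toFinset] at hP
    by_contra hne
    exact hP.1 ⟨Q, h, fun hd0 => hne (h.ramificationIndex_eq_one hd0)⟩

variable {F'' : Type*} [Field F''] [Algebra k F''] [Algebra F' F''] [Algebra F F'']
  [IsScalarTower F F' F''] [IsScalarTower k F' F''] [IsScalarTower k F F'']
  [FiniteDimensional F' F''] [Algebra.IsSeparable F' F'']
  [FiniteDimensional F F''] [Algebra.IsSeparable F F'']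

/-- A lifting of a lifting is a lifting. -/
theorem IsLifting.trans (hF : IsFunctionField k F) (hF' : IsFunctionField k F')
    (hs : ∀ P ∈ C.D.support, P.SplitsCompletely F'') {C' : AGCode k F'} {C'' : AGCode k F''}
    (h : C.IsLifting C') (h' : C'.IsLifting C'') : C.IsLifting C'' := by
  obtain ⟨E, hE, hG⟩ := h.G_eq
  obtain ⟨E', hE', hG'⟩ := h'.G_eq
  refine ⟨hs, by rw [h'.D_eq, h.D_eq, conorm_conorm], E.conorm F'' + E', ?_, ?_⟩
  · rw [smul_add, ← conorm_nsmul, hE, hE', ← different_tower hF hF']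
  · rw [hG', hG, conorm_add, conorm_conorm, add_assoc]

theorem IsLifting.splits_tower (hs : ∀ P ∈ C.D.support, P.SplitsCompletely F'')
    {C' : AGCode k F'} (h : C.IsLifting C') : ∀ Q ∈ C'.D.support, Q.SplitsCompletely F'' := by
  intro Q hQ
  rw [h.D_eq] at hQ
  have hl := Q.liesOver_below (F := F)
  exact (hs _ ((mem_support_conorm hl).mp hQ)).of_tower.2 Q hl

end AGCode

end AGLift

/-! ### The tower theorem -/

theorem mainTheorem5 {k F₀ F₁ F₂ : Type*} [Field k] [Finite k] [Field F₀] [Field F₁] [Field F₂]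
    [Algebra k F₀] [Algebra k F₁] [Algebra k F₂] [Algebra F₀ F₁] [Algebra F₁ F₂] [Algebra F₀ F₂]
    [IsScalarTower k F₀ F₁] [IsScalarTower k F₁ F₂] [IsScalarTower F₀ F₁ F₂]
    (hF₀ : AGLift.IsFunctionField k F₀) (hF₁ : AGLift.IsFunctionField k F₁)
    (hF₂ : AGLift.IsFunctionField k F₂)
    [FiniteDimensional F₀ F₁] [FiniteDimensional F₁ F₂]
    [Algebra.IsSeparable F₀ F₁] [Algebra.IsSeparable F₁ F₂]
    (hd₁ : ∀ (P : AGLift.Place k F₀) (Q : AGLift.Place k F₁), Q.LiesOver P →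
      Even (Q.differentExponent P))
    (hd₂ : ∀ (Q : AGLift.Place k F₁) (R : AGLift.Place k F₂), R.LiesOver Q →
      Even (R.differentExponent Q))
    (C : AGLift.AGCode k F₀) (hsplit : ∀ P ∈ C.D.support, P.SplitsCompletely F₂) :
    -- all the liftings are defined
    (C.lifting F₁).Dom ∧ (∀ C₁ ∈ C.lifting F₁, (C₁.lifting F₂).Dom) ∧ (C.lifting F₂).Dom ∧
    -- lifting step by step is lifting directly, for the defining divisors and for the codes
    (C.lifting F₁).bind (fun C₁ => C₁.lifting F₂) = C.lifting F₂ ∧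
    ((C.lifting F₁).bind (fun C₁ => C₁.lifting F₂)).map AGLift.AGCode.toCode =
      (C.lifting F₂).map AGLift.AGCode.toCode ∧
    -- the standard hypotheses for lifting persist at every step
    (Even C.length → 0 < C.G.degree →
      C.LiftingHypotheses F₁ ∧ (∀ C₁ ∈ C.lifting F₁, C₁.LiftingHypotheses F₂) ∧
        C.LiftingHypotheses F₂) := by
  have : IsScalarTower k F₀ F₂ := .of_algebraMap_eq fun c => by
    rw [IsScalarTower.algebraMap_apply k F₁ F₂, IsScalarTower.algebraMap_apply k F₀ F₁,
      ← IsScalarTower.algebraMap_apply F₀ F₁ F₂]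
  have : FiniteDimensional F₀ F₂ := .trans F₀ F₁ F₂
  have : Algebra.IsSeparable F₀ F₂ := .trans F₀ F₁ F₂
  have hd : ∀ (P : AGLift.Place k F₀) (R : AGLift.Place k F₂), R.LiesOver P →
      Even (R.differentExponent P) := fun P R hR => by
    have h' := R.liesOver_below (F := F₁)
    have h := hR.of_tower h'
    rw [h'.differentExponent_trans h]
    exact ((hd₁ _ _ h).mul_left _).add (hd₂ _ _ h')
  have hsplit₁ : ∀ P ∈ C.D.support, P.SplitsCompletely F₁ :=
    fun P hP => (hsplit P hP).of_tower.1
  have hex₁ : ∃ C₁ : AGLift.AGCode k F₁, C.IsLifting C₁ :=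
    AGLift.AGCode.exists_isLifting hF₀ hd₁ hsplit₁
  have hex₂ : ∀ C₁ : AGLift.AGCode k F₁, C.IsLifting C₁ →
      ∃ C₂ : AGLift.AGCode k F₂, C₁.IsLifting C₂ := fun C₁ h =>
    AGLift.AGCode.exists_isLifting hF₁ hd₂ (h.splits_tower hsplit)
  have heq : (C.lifting F₁).bind (fun C₁ => C₁.lifting F₂) = C.lifting F₂ := by
    ext C₂
    simp only [Part.mem_bind_iff, AGLift.AGCode.mem_lifting_iff]
    constructor
    · rintro ⟨C₁, h₁, h₂⟩
      exact h₁.trans hF₀ hF₁ hsplit h₂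
    · intro h
      obtain ⟨C₁, h₁⟩ := hex₁
      obtain ⟨C₂', h₂⟩ := hex₂ C₁ h₁
      -- The two-step lifting exists and is itself a direct lifting, so uniqueness identifies it
      -- with C₂.
      exact ⟨C₁, h₁, h.unique (h₁.trans hF₀ hF₁ hsplit h₂) ▸ h₂⟩
  refine ⟨hex₁, fun C₁ h => hex₂ C₁ (AGLift.AGCode.mem_lifting_iff.mp h),
    AGLift.AGCode.exists_isLifting hF₀ hd hsplit, heq, by rw [heq], fun he hG => ?_⟩
  refine ⟨AGLift.AGCode.liftingHypotheses hF₀ hd₁ hsplit₁ he hG, fun C₁ h => ?_,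
    AGLift.AGCode.liftingHypotheses hF₀ hd hsplit he hG⟩
  rw [AGLift.AGCode.mem_lifting_iff] at h
  exact AGLift.AGCode.liftingHypotheses hF₁ hd₂ (h.splits_tower hsplit) (h.even_length he)
    (h.degree_pos hF₀ hG)
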